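/- Let $n\ge 0$ and equip $\mathbb{R}^n$ with its standard Euclidean inner product; write $(\cdot,\cdot)$ also for its complex bilinear extension to $\mathbb{C}^n$. A "circle" in $\mathbb{R}^n$ means a (nondegenerate) circle or a straight line. A simple bundle of circles is a set of circles passing through $0$, no two of which are tangent at $0$; it is complete if for each direction at $0$ it contains exactly one circle having that direction. A bundle $\mathcal{S}$ is rectifiable if there is a germ at $0$ of a ($C^\infty$) diffeomorphism of $\mathbb{R}^n$ that sends (the germs at $0$ of) all curves of $\mathcal{S}$ to (germs of) straight lines. Call a homogeneous quadratic map $\Gamma:\mathbb{C}^n\to\mathbb{C}^n$ admissible if it is defined over the reals, i.e. $\Gamma(\mathbb{R}^n)\subseteq\mathbb{R}^n$, and satisfies $(x,\Gamma(x))=(\Gamma(x),\Gamma(x))=0$ for all $x\in\mathbb{C}^n$ with $(x,x)=0$. Call two admissible maps equivalent if they differ by a map of the form $x\mapsto\lambda(x)x$ with $\lambda$ a linear functional. Theorem. Complete rectifiable bundles of circles in $\mathbb{R}^n$ are in one-to-one correspondence with equivalence classes of admissible quadratic maps. The correspondence assigns to a bundle $\mathcal{S}$ the class of the quadratic part of any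 diffeomorphism rectifying it. Precisely: there is a bijection $e$ from the set of complete rectifiable bundles of circles onto the set of equivalence classes of admissible maps such that, for every complete rectifiable bundle $\mathcal{S}$ and every homogeneous quadratic map $\Gamma:\mathbb{C}^n\to\mathbb{C}^n$, the following are equivalent: (i) there is a germ of diffeomorphism $\Phi:(\mathbb{R}^n,0)\to(\mathbb{R}^n,0)$ with $\Phi(x)=x+\Gamma(x)+o(|x|^2)$ as $x\to 0$ such that $\Phi^{-1}$ sends all curves of $\mathcal{S}$ to straight lines; (ii) $\Gamma$ is admissible and $e(\mathcal{S})$ is the equivalence class of $\Gamma$. -/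

import Mathlib

open scoped Topology ContDiff Matrix

namespace CircleBundle

/-- The space `ℝⁿ` with its standard Euclidean inner product. -/
abbrev Euc (n : ℕ) : Type := EuclideanSpace ℝ (Fin n)

/-- A straight line in `ℝⁿ` (a one-dimensional affine subspace). -/
def IsLine {n : ℕ} (L : AffineSubspace ℝ (Euc n)) : Prop :=
  Module.finrank ℝ L.direction = 1

/-- A "circle": either a straight line, or the set of points of an affine 2-plane
lying at a fixed positive distance from a point of this plane. -/
def IsCircle {n : ℕ} (S : Set (Euc n)) : Prop :=
  (∃ L : AffineSubspace ℝ (Euc n), IsLine L ∧ S = (L : Set (Euc n))) ∨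
  (∃ P : AffineSubspace ℝ (Euc n), Module.finrank ℝ P.direction = 2 ∧
    ∃ c ∈ P, ∃ r : ℝ, 0 < r ∧ S = (P : Set (Euc n)) ∩ Metric.sphere c r)

/-- The vector `v` is a (nonzero) tangent vector of `S` at the origin. -/
def HasDirection {n : ℕ} (S : Set (Euc n)) (v : Euc n) : Prop :=
  v ≠ 0 ∧ v ∈ tangentConeAt ℝ S 0

/-- A simple bundle of circles: a collection of circles passing through the origin,
no two of which are tangent there. -/
structure IsSimpleBundle {n : ℕ} (B : Set (Set (Euc n))) : Prop where
  isCircle : ∀ S ∈ B, IsCircle S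
  zero_mem : ∀ S ∈ B, (0 : Euc n) ∈ S
  not_tangent : ∀ S ∈ B, ∀ T ∈ B, S ≠ T → ∀ v : Euc n, ¬ (HasDirection S v ∧ HasDirection T v)

/-- A complete bundle: in each direction there goes a unique circle of the bundle. -/
structure IsCompleteBundle {n : ℕ} (B : Set (Set (Euc n))) : Prop extends IsSimpleBundle B where
  existsUnique : ∀ v : Euc n, v ≠ 0 → ∃! S : Set (Euc n), S ∈ B ∧ HasDirection S v

/-- `Φ` represents a germ at the origin of a (`C^∞`) diffeomorphism of `ℝⁿ`. -/
structure IsDiffeoGerm {n : ℕ} (Φ : OpenPartialHomeomorph (Euc n) (Euc n)) : Prop where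
  zero_mem_source : (0 : Euc n) ∈ Φ.source
  contDiffOn : ContDiffOn ℝ ∞ Φ Φ.source
  contDiffOn_symm : ContDiffOn ℝ ∞ Φ.symm Φ.target

/-- The germ of `Ψ` at the origin sends (the germ of) each curve of `B` to (the germ of)
a straight line. -/
def Straightens {n : ℕ} (Ψ : OpenPartialHomeomorph (Euc n) (Euc n))
    (B : Set (Set (Euc n))) : Prop :=
  ∀ S ∈ B, ∃ L : AffineSubspace ℝ (Euc n), IsLine L ∧ ∀ᶠ x in 𝓝 (0 : Euc n), (x ∈ S ↔ Ψ x ∈ L)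

/-- A bundle of curves through the origin is rectifiable if some germ of diffeomorphism at the
origin sends all its curves to straight lines. -/
def IsRectifiable {n : ℕ} (B : Set (Set (Euc n))) : Prop :=
  ∃ Ψ : OpenPartialHomeomorph (Euc n) (Euc n), IsDiffeoGerm Ψ ∧ Straightens Ψ B

/-- The complete rectifiable bundles of circles in `ℝⁿ`. -/
abbrev CompleteRectifiableBundle (n : ℕ) : Type :=
  {B : Set (Set (Euc n)) // IsCompleteBundle B ∧ IsRectifiable B}

/-- Quadratic homogeneous maps `ℂⁿ → ℂⁿ`. -/
abbrev QuadMap (n : ℕ) : Type := QuadraticMap ℂ (Fin n → ℂ) (Fin n → ℂ)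

/-- The inclusion `ℝⁿ ⊂ ℂⁿ`. -/
def toComplex {n : ℕ} (x : Euc n) : Fin n → ℂ := fun i => (x i : ℂ)

/-- `Γ` is defined over reals and satisfies `(x, Γ(x)) = (Γ(x), Γ(x)) = 0` on the asymptotic cone
`(x, x) = 0`; here `(·,·)` is the complex bilinear extension of the inner product, which in
coordinates is the dot product. -/
structure IsAdmissible {n : ℕ} (Γ : QuadMap n) : Prop where
  real : ∀ x : Euc n, ∃ y : Euc n, Γ (toComplex x) = toComplex y
  orthogonal : ∀ x : Fin n → ℂ, x ⬝ᵥ x = 0 → x ⬝ᵥ Γ x = 0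
  isotropic : ∀ x : Fin n → ℂ, x ⬝ᵥ x = 0 → Γ x ⬝ᵥ Γ x = 0

/-- Two admissible quadratic maps are equivalent if they differ by a map `x ↦ λ(x) x` with `λ` a
linear functional. -/
instance admissibleSetoid (n : ℕ) : Setoid {Γ : QuadMap n // IsAdmissible Γ} where
  r Γ Γ' := ∃ l : (Fin n → ℂ) →ₗ[ℂ] ℂ, ∀ x, Γ'.1 x = Γ.1 x + l x • x
  iseqv :=
    { refl := fun Γ => ⟨0, fun x => by simp⟩
      symm := by
        rintro Γ Γ' ⟨l, hl⟩
        exact ⟨-l, fun x => by rw [hl x]; simp⟩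
      trans := by
        rintro Γ Γ' Γ'' ⟨l, hl⟩ ⟨m, hm⟩
        exact ⟨l + m, fun x => by rw [hm x, hl x, LinearMap.add_apply, add_smul, add_assoc]⟩ }

/-- `Γ` is the quadratic part of a germ of diffeomorphism `Φ : (ℝⁿ, 0) → (ℝⁿ, 0)` with identity
differential at the origin, `Φ(x) = x + Γ(x) + o(|x|²)`, whose inverse sends all curves of `B` to
straight lines. -/
def IsQuadraticPartOf {n : ℕ} (Γ : QuadMap n) (B : Set (Set (Euc n))) : Prop :=
  ∃ Φ : OpenPartialHomeomorph (Euc n) (Euc n), IsDiffeoGerm Φ ∧ Φ 0 = 0 ∧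
    Straightens Φ.symm B ∧
    (fun x : Euc n => toComplex (Φ x) - toComplex x - Γ (toComplex x))
      =o[𝓝 (0 : Euc n)] (fun x : Euc n => ‖x‖ ^ 2)

end CircleBundle

/-! Let `Φ x = x + G x + o(|x|²)` be inverse to a rectifying germ. The curve of the bundle with
direction `v` is locally the image of the line through `v`, so it has the same 2-jet as `t v + t²
G(v)`. A circle through `0` is determined by its 2-jet; hence the curve is `circ v (perp v (G v))`.
So `G` determines the bundle, and the bundle determines each `G v` modulo `v`
(`StraightensWith.eq_setOf`, `StraightensWith.perp_eq`).

Admissibility comes from the 4-jet `t v + t² G(v) + t³ T(v) + t⁴ F(v)` of `Φ (t v)`. Its lying on a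
circle means that `T` is in the span of `v` and `G v`, together with one polynomial identity each at
orders `t³` and `t⁴` (`taylor_coeffs_of_circ`). On `v = u + s w` these are polynomial identities in
`s`, so they persist at `s = i`. If `u + i w` is isotropic, the order-3 identity reduces to `(x, Γ
x)³ = 0`, and the order-4 identity, divided by `s - i`, gives `(Γ x, Γ x)² = 0`
(`StraightensWith.isotropic`).

Conversely, vanishing on the isotropic cone means divisibility by `(x, x)`: `(x, G x) = (x, x) l(x)`
and `(G x, G x) = (x, x) Q(x)` (`exists_linear_factor`, `exists_quadratic_factor`). Subtracting
`l(x) x` makes `G x` orthogonal to `x`, and then `x ↦ (x + G x) / (1 + μ x)`, with `(G x, G x) = (x,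
x) μ x`, is smooth and carries lines to circles (`exists_bundle`).

Adding `l(x) x` to `G` amounts to composing `Φ` with `x ↦ (1 + l x) x`, which preserves lines
through `0` (`StraightensWith.add_smulSelf`). Two quadratic parts of one bundle differ in this way:
the difference is a multiple of `x`, and the multiplier is linear by the same divisibility
(`StraightensWith.exists_eq_add_smulSelf`). -/

namespace CircleBundle

open scoped RealInnerProductSpace
open Filter Asymptotics

/-! ### Homogeneous forms described plane by plane, and Taylor expansion into them. -/

section Forms

universe u
variable {E F : Type u}

/-- A map between real vector spaces whose restriction to each plane is a binary form of
degree `j`. -/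
def IsForm [AddCommGroup E] [Module ℝ E] [AddCommGroup F] [Module ℝ F] (j : ℕ) (p : E → F) :
    Prop :=
  ∀ u v : E, ∃ c : ℕ → F, ∀ a b : ℝ,
    p (a • u + b • v) = ∑ i ∈ Finset.range (j + 1), (a ^ (j - i) * b ^ i) • c i

/-- As in the Jordan–von Neumann theorem: the parallelogram law involves only two vectors, so it
holds planewise, and it forces the polar form to be additive. -/
theorem exists_quadraticMap_of_isForm_two [AddCommGroup E] [Module ℝ E] [AddCommGroup F]
    [Module ℝ F] {p : E → F} (hp : IsForm 2 p) : ∃ Q : QuadraticMap ℝ E F, ∀ x, Q x = p x := by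
  have h : ∀ u v : E, ∃ c₀ c₁ c₂ : F, ∀ a b : ℝ,
      p (a • u + b • v) = a ^ 2 • c₀ + (a * b) • c₁ + b ^ 2 • c₂ := by
    intro u v
    obtain ⟨c, hc⟩ := hp u v
    refine ⟨c 0, c 1, c 2, fun a b => ?_⟩
    rw [hc]
    simp [Finset.sum_range_succ]
  have hsmul : ∀ (a : ℝ) (x : E), p (a • x) = (a * a) • p x := by
    intro a x
    obtain ⟨c₀, c₁, c₂, hc⟩ := h x 0
    have h1 := hc a 0
    have h2 := hc 1 0
    simp only [smul_zero, add_zero, one_smul] at h1 h2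
    rw [h1, h2]
    module
  have par : ∀ x y : E, p (x + y) + p (x - y) = (2 : ℝ) • p x + (2 : ℝ) • p y := by
    intro x y
    obtain ⟨c₀, c₁, c₂, hc⟩ := h x y
    have h1 := hc 1 1
    have h2 := hc 1 (-1)
    have h3 := hc 1 0
    have h4 := hc 0 1
    simp only [one_smul, zero_smul, add_zero, zero_add, neg_smul, ← sub_eq_add_neg] at h1 h2 h3 h4
    rw [h1, h2, h3, h4]
    module
  refine ⟨QuadraticMap.ofPolar p hsmul ?_ ?_, fun x => rfl⟩
  · intro x y z
    have h1 := par (x + y) z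
    have h2 := par (x + z) y
    have h4 := par x (y - z)
    have h5 := par y z
    have e2 : x + z + y = x + y + z := by abel
    have e3 : x + z - y = x - (y - z) := by abel
    have e4 : x + (y - z) = x + y - z := by abel
    rw [e2, e3] at h2
    rw [e4] at h4
    simp only [QuadraticMap.polar]
    linear_combination (norm := module) (1 / 2 : ℝ) • (h1 + h2 - h4) - h5
  · intro a x y
    obtain ⟨c₀, c₁, c₂, hc⟩ := h x y
    have h1 := hc a 1
    have h2 := hc 1 1
    have h3 := hc 1 0
    have h4 := hc 0 1
    simp only [one_smul, zero_smul, add_zero, zero_add] at h1 h2 h3 h4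
    simp only [QuadraticMap.polar, hsmul]
    rw [h1, h2, h3, h4]
    module

theorem IsForm.map_smul [AddCommGroup E] [Module ℝ E] [AddCommGroup F]
    [Module ℝ F] {j : ℕ} {p : E → F} (hp : IsForm j p) (t : ℝ) (x : E) :
    p (t • x) = t ^ j • p x := by
  obtain ⟨c, hc⟩ := hp x 0
  have h1 := hc t 0
  have h2 := hc 1 0
  rw [Finset.sum_range_succ'] at h1 h2
  simp at h1 h2
  rw [h1, h2]

variable [NormedAddCommGroup E] [NormedSpace ℝ E] [NormedAddCommGroup F] [NormedSpace ℝ F]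

theorem IsForm.apply_self {j : ℕ} {p : E → E →L[ℝ] F} (hp : IsForm j p) (r : ℝ) :
    IsForm (j + 1) (fun x => r • p x x) := by
  intro u v
  obtain ⟨c, hc⟩ := hp u v
  refine ⟨fun i => r • ((if i < j + 1 then c i u else 0) + (if 0 < i then c (i - 1) v else 0)),
    fun a b => ?_⟩
  have h1 : ∑ i ∈ Finset.range (j + 1 + 1), (a ^ (j + 1 - i) * b ^ i) •
      r • (if i < j + 1 then c i u else 0) =
      ∑ i ∈ Finset.range (j + 1), (a ^ (j - i) * b ^ i) • r • a • c i u := by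
    rw [Finset.sum_range_succ]
    simp only [lt_irrefl, if_false, smul_zero, add_zero]
    refine Finset.sum_congr rfl fun i hi => ?_
    rw [Finset.mem_range] at hi
    rw [if_pos hi, Nat.succ_sub (Nat.lt_succ_iff.mp hi), pow_succ]
    module
  have h2 : ∑ i ∈ Finset.range (j + 1 + 1), (a ^ (j + 1 - i) * b ^ i) •
      r • (if 0 < i then c (i - 1) v else 0) =
      ∑ i ∈ Finset.range (j + 1), (a ^ (j - i) * b ^ i) • r • b • c i v := by
    rw [Finset.sum_range_succ']
    simp only [lt_irrefl, if_false, smul_zero, add_zero, Nat.succ_pos, if_true,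
      Nat.add_sub_cancel]
    refine Finset.sum_congr rfl fun i hi => ?_
    rw [Nat.add_sub_add_right, pow_succ]
    module
  simp only [smul_add, Finset.sum_add_distrib] at h1 h2 ⊢
  rw [h1, h2, ← Finset.sum_add_distrib, hc, sum_apply, Finset.smul_sum]
  refine Finset.sum_congr rfl fun i _ => ?_
  rw [smul_apply, map_add, (c i).map_smul, (c i).map_smul]
  module

/-- Induction on the order through the derivative, integrated back along rays. The step replaces `F`
by `E →L[ℝ] F`, so `F` is quantified inside and shares the universe of `E`. -/
theorem exists_taylor_forms (k : ℕ) : ∀ {F : Type u} [NormedAddCommGroup F] [NormedSpace ℝ F]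
    {f : E → F}, ContDiffAt ℝ ∞ f 0 → ∃ p : ℕ → E → F, (∀ j, IsForm j (p j)) ∧
      (fun x => f x - ∑ j ∈ Finset.range (k + 1), p j x) =o[𝓝 0] fun x => ‖x‖ ^ k := by
  induction k with
  | zero =>
    intro F _ _ f hf
    refine ⟨fun j _ => if j = 0 then f 0 else 0, fun j u v => ?_, ?_⟩
    · refine ⟨fun _ => if j = 0 then f 0 else 0, fun a b => ?_⟩
      by_cases hj : j = 0
      · subst hj; simp
      · simp [hj]
    · simp only [zero_add, Finset.sum_range_one, if_true, pow_zero]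
      rw [Asymptotics.isLittleO_one_iff]
      have := hf.continuousAt.tendsto.sub_const (f 0)
      simpa using this
  | succ k ih =>
    intro F _ _ f hf
    have hf' : ContDiffAt ℝ ∞ (fderiv ℝ f) 0 := hf.fderiv_right (by simp)
    obtain ⟨p, hp, ho⟩ := ih hf'
    -- Integrating `p i (t x) x = t^i p i x x` over `[0, 1]` produces the factor `1 / (i + 1)`.
    refine ⟨fun j => Nat.casesOn j (fun _ => f 0) (fun i x => (1 / ((i : ℝ) + 1)) • p i x x),
      fun j => ?_, ?_⟩
    · cases j with
      | zero => exact fun u v => ⟨fun _ => f 0, fun a b => by simp⟩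
      | succ i => exact (hp i).apply_self _
    rw [Asymptotics.isLittleO_iff] at ho ⊢
    intro ε hε
    have hd : ∀ᶠ x in 𝓝 (0 : E), DifferentiableAt ℝ f x := by
      filter_upwards [(hf.of_le (m := 1) (by norm_cast)).eventually (by simp)] with x hx
      exact hx.differentiableAt (by simp)
    obtain ⟨δ, hδ, hball⟩ := Metric.eventually_nhds_iff.mp ((ho hε).and hd)
    refine Metric.eventually_nhds_iff.mpr ⟨δ, hδ, fun x hx => ?_⟩
    have hx' : ∀ t : ℝ, t ∈ Set.Icc (0 : ℝ) 1 → ‖t • x‖ ≤ ‖x‖ := by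
      intro t ht
      rw [norm_smul, Real.norm_of_nonneg ht.1]
      exact mul_le_of_le_one_left (norm_nonneg _) ht.2
    have hx'' : ∀ t : ℝ, t ∈ Set.Icc (0 : ℝ) 1 → dist (t • x) 0 < δ := by
      intro t ht
      rw [dist_zero_right] at hx ⊢
      exact (hx' t ht).trans_lt hx
    -- The remainder along the ray; its derivative is the remainder of `fderiv ℝ f` applied to `x`,
    -- and the mean value inequality bounds its increment.
    let h : ℝ → F := fun t => f (t • x) -
      ∑ j ∈ Finset.range (k + 1), (t ^ (j + 1)) • ((1 / ((j : ℝ) + 1)) • p j x x)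
    have hderiv : ∀ t ∈ Set.Icc (0 : ℝ) 1, HasDerivAt h ((fderiv ℝ f (t • x) -
        ∑ j ∈ Finset.range (k + 1), p j (t • x)) x) t := by
      intro t ht
      have h1 : HasDerivAt (fun t : ℝ => t • x) x t := by
        simpa using (hasDerivAt_id t).smul_const x
      have h2 := ((hball (hx'' t ht)).2.hasFDerivAt).comp_hasDerivAt t h1
      have h3 : HasDerivAt (fun t : ℝ => ∑ j ∈ Finset.range (k + 1),
          (t ^ (j + 1)) • ((1 / ((j : ℝ) + 1)) • p j x x))
          (∑ j ∈ Finset.range (k + 1), p j (t • x) x) t := by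
        refine HasDerivAt.fun_sum fun j _ => ?_
        have h4 := (hasDerivAt_pow (j + 1) t).smul_const ((1 / ((j : ℝ) + 1)) • p j x x)
        convert h4 using 1
        rw [(hp j).map_smul, smul_apply, smul_smul]
        congr 1
        have : (j : ℝ) + 1 ≠ 0 := by positivity
        push_cast
        simp
        field_simp
      refine (h2.sub h3).congr_deriv ?_
      simp
    have key := norm_image_sub_le_of_norm_deriv_le_segment_01' (f := h) (C := ε * ‖x‖ ^ (k + 1))
      (fun t ht => (hderiv t ht).hasDerivWithinAt) (fun t ht => ?_)
    · have e1 : h 1 - h 0 = f x - ∑ j ∈ Finset.range (k + 1 + 1),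
          (Nat.casesOn j (fun _ => f 0) (fun i x => (1 / ((i : ℝ) + 1)) • p i x x) : E → F) x := by
        rw [Finset.sum_range_succ']
        simp only [h, one_smul, one_pow, zero_smul]
        simp
        abel
      rw [← e1]
      simpa using key
    · have ht' := Set.Ico_subset_Icc_self ht
      refine (ContinuousLinearMap.le_opNorm _ _).trans ?_
      have h5 := (hball (hx'' t ht')).1
      rw [pow_succ, ← mul_assoc]
      refine mul_le_mul_of_nonneg_right (h5.trans ?_) (norm_nonneg _)
      rw [norm_pow, norm_norm]
      gcongr
      exact hx' t ht'

theorem contDiff_quadraticMap [FiniteDimensional ℝ E] (Q : QuadraticMap ℝ E F) {m : WithTop ℕ∞} :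
    ContDiff ℝ m Q := by
  have : ∀ x, Q x = (1 / 2 : ℝ) • (LinearMap.toContinuousLinearMap
      ((LinearMap.toContinuousLinearMap (E := E) (F' := F) (𝕜 := ℝ)).toLinearMap ∘ₗ Q.polarBilin)) x x := by
    intro x
    simp [QuadraticMap.polar_self, ← Nat.cast_smul_eq_nsmul ℝ, smul_smul]
  rw [show (Q : E → F) = _ from funext this]
  fun_prop

end Forms

/-! ### Circles through the origin: equation, parametrization, tangent and 2-jet. -/

section Circles

variable {n : ℕ}

theorem exists_isDiffeoGerm_of_hasFDerivAt_id {f : Euc n → Euc n} (hf : ContDiff ℝ ∞ f)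
    (hd : HasFDerivAt f (ContinuousLinearMap.id ℝ (Euc n)) 0) :
    ∃ Φ : OpenPartialHomeomorph (Euc n) (Euc n), IsDiffeoGerm Φ ∧ ⇑Φ = f := by
  have hd' : HasFDerivAt f ((ContinuousLinearEquiv.refl ℝ (Euc n) : Euc n →L[ℝ] Euc n)) 0 := hd
  -- The inverse must be smooth on the whole target, so the domain is cut down to points with
  -- invertible derivative.
  set s : Set (Euc n) := {x | fderiv ℝ f x ∈
    Set.range ((↑) : (Euc n ≃L[ℝ] Euc n) → Euc n →L[ℝ] Euc n)} with hs
  have hso : IsOpen s :=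
    ContinuousLinearEquiv.isOpen.preimage (hf.continuous_fderiv (by simp))
  refine ⟨(hf.contDiffAt.toOpenPartialHomeomorph f hd' (by simp)).restrOpen s hso, ⟨?_, ?_, ?_⟩, rfl⟩
  · rw [OpenPartialHomeomorph.restrOpen_source]
    refine ⟨hf.contDiffAt.mem_toOpenPartialHomeomorph_source hd' (by simp), ?_⟩
    exact ⟨_, hd'.fderiv.symm⟩
  · exact hf.contDiffOn
  · intro y hy
    have hy' := ((hf.contDiffAt.toOpenPartialHomeomorph f hd' (by simp)).restrOpen s hso).map_target hy
    rw [OpenPartialHomeomorph.restrOpen_source] at hy'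
    obtain ⟨e, he⟩ := hy'.2
    refine (OpenPartialHomeomorph.contDiffAt_symm (f₀' := e) _ hy ?_ hf.contDiffAt).contDiffWithinAt
    rw [he]
    exact (hf.contDiffAt.differentiableAt (by simp)).hasFDerivAt

/-- For `w` orthogonal to `v ≠ 0`, the circle (or line, if `w = 0`) osculating at the origin the
curve `t ↦ t v + t² w`. -/
def circ (v w : Euc n) : Set (Euc n) :=
  {y | y ∈ Submodule.span ℝ {v, w} ∧ ⟪y, y⟫ * ⟪w, w⟫ = ⟪v, v⟫ * ⟪y, w⟫}

/-- The component of `g` orthogonal to `v`. -/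
noncomputable def perp (v g : Euc n) : Euc n := g - (⟪v, g⟫ / ⟪v, v⟫) • v

theorem inner_perp {v : Euc n} (hv : v ≠ 0) (g : Euc n) : ⟪v, perp v g⟫ = 0 := by
  have : ⟪v, v⟫ ≠ 0 := inner_self_ne_zero.mpr hv
  rw [perp, inner_sub_right, inner_smul_right, div_mul_cancel₀ _ this, sub_self]

theorem perp_add_smul {v : Euc n} (hv : v ≠ 0) (g : Euc n) (a : ℝ) :
    perp v (g + a • v) = perp v g := by
  have : ⟪v, v⟫ ≠ 0 := inner_self_ne_zero.mpr hv
  rw [perp, perp, inner_add_right, inner_smul_right, add_div, mul_div_cancel_right₀ _ this]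
  module

theorem perp_of_inner_eq_zero {v w : Euc n} (h : ⟪v, w⟫ = 0) : perp v w = w := by
  rw [perp, h]; simp

/-- The substitution `t ↦ a t` in `t v + t² w`. For homogeneous quadratic `G` it makes `circ v (G
v)` depend only on the line of `v`. -/
theorem circ_smul {a : ℝ} (ha : a ≠ 0) (v w : Euc n) : circ (a • v) (a ^ 2 • w) = circ v w := by
  have h : Submodule.span ℝ {a • v, a ^ 2 • w} = Submodule.span ℝ {v, w} := by
    rw [Submodule.span_insert, Submodule.span_insert,
      Submodule.span_singleton_smul_eq (IsUnit.mk0 a ha),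
      Submodule.span_singleton_smul_eq (IsUnit.mk0 _ (pow_ne_zero 2 ha))]
  ext y
  simp only [circ, h, Set.mem_ofPred_eq, inner_smul_left, inner_smul_right, RCLike.conj_to_real]
  refine and_congr_right fun _ => ?_
  have h4 : a ^ 4 ≠ 0 := pow_ne_zero _ ha
  constructor
  · intro h
    refine mul_left_cancel₀ h4 ?_
    linear_combination h
  · intro h
    linear_combination a ^ 4 * h

theorem zero_mem_circ (v w : Euc n) : (0 : Euc n) ∈ circ v w :=
  ⟨Submodule.zero_mem _, by simp⟩

theorem isCircle_circ {v w : Euc n} (hv : v ≠ 0) (h : ⟪v, w⟫ = 0) : IsCircle (circ v w) := by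
  have hvv : ⟪v, v⟫ ≠ 0 := inner_self_ne_zero.mpr hv
  by_cases hw : w = 0
  · refine Or.inl ⟨(Submodule.span ℝ {v}).toAffineSubspace, ?_, ?_⟩
    · rw [IsLine, Submodule.toAffineSubspace_direction]
      exact finrank_span_singleton hv
    · ext y
      simp [circ, hw, Submodule.span_insert]
  · have hww : ⟪w, w⟫ ≠ 0 := inner_self_ne_zero.mpr hw
    refine Or.inr ⟨(Submodule.span ℝ {v, w}).toAffineSubspace, ?_, (⟪v, v⟫ / (2 * ⟪w, w⟫)) • w,
      ?_, ‖(⟪v, v⟫ / (2 * ⟪w, w⟫)) • w‖, ?_, ?_⟩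
    · rw [Submodule.toAffineSubspace_direction]
      have hli : LinearIndependent ℝ ![v, w] := by
        rw [LinearIndependent.pair_iff]
        intro s t hst
        have h1 : ⟪v, s • v + t • w⟫ = 0 := by rw [hst, inner_zero_right]
        have h2 : ⟪w, s • v + t • w⟫ = 0 := by rw [hst, inner_zero_right]
        rw [inner_add_right, inner_smul_right, inner_smul_right, h] at h1
        rw [inner_add_right, inner_smul_right, inner_smul_right, real_inner_comm, h] at h2
        simp_all
      have := finrank_span_eq_card hli
      rwa [Matrix.range_cons_cons_empty, Fintype.card_fin] at this
    · rw [Submodule.mem_toAffineSubspace]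
      exact Submodule.smul_mem _ _ (Submodule.subset_span (by simp))
    · rw [norm_pos_iff]
      exact smul_ne_zero (div_ne_zero hvv (mul_ne_zero two_ne_zero hww)) hw
    · ext y
      simp only [circ, Set.mem_inter_iff, SetLike.mem_coe, Submodule.mem_toAffineSubspace,
        mem_sphere_iff_norm, Set.mem_ofPred_eq]
      refine and_congr_right fun _ => ?_
      rw [← sq_eq_sq₀ (norm_nonneg _) (norm_nonneg _), norm_sub_sq_real, inner_smul_right,
        ← real_inner_self_eq_norm_sq y]
      constructor
      · intro h
        field_simp
        linear_combination h
      · intro h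
        field_simp at h
        linear_combination h

theorem exists_eq_circ {S : Set (Euc n)} (hS : IsCircle S) (h0 : (0 : Euc n) ∈ S) :
    ∃ v w : Euc n, v ≠ 0 ∧ ⟪v, w⟫ = 0 ∧ S = circ v w := by
  rcases hS with ⟨L, hL, rfl⟩ | ⟨P, hP, c, hc, r, hr, rfl⟩
  · obtain ⟨v, hv, hspan⟩ := finrank_eq_one_iff'.mp hL
    refine ⟨v, 0, by simpa using hv, inner_zero_right _, ?_⟩
    ext y
    have h1 : y ∈ L ↔ y ∈ L.direction := by
      rw [← AffineSubspace.vsub_right_mem_direction_iff_mem h0]; simp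
    have h2 : y ∈ L.direction ↔ y ∈ Submodule.span ℝ {(v : Euc n)} := by
      rw [Submodule.mem_span_singleton]
      constructor
      · intro hy
        obtain ⟨a, ha⟩ := hspan ⟨y, hy⟩
        exact ⟨a, congrArg Subtype.val ha⟩
      · rintro ⟨a, rfl⟩
        exact L.direction.smul_mem _ v.2
    simp only [SetLike.mem_coe, h1, h2]
    simp [circ, Submodule.span_insert]
  · have h1 : ∀ y, y ∈ P ↔ y ∈ P.direction := fun y => by
      rw [← AffineSubspace.vsub_right_mem_direction_iff_mem h0.1]; simp
    have hcr : ‖c‖ = r := by simpa using h0.2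
    have hc0 : c ≠ 0 := by rw [← norm_pos_iff, hcr]; exact hr
    have hcc : ⟪c, c⟫ ≠ 0 := inner_self_ne_zero.mpr hc0
    have hcd : c ∈ P.direction := (h1 c).mp hc
    have hle : Submodule.span ℝ {c} ≤ P.direction := by simpa using hcd
    have hf := Submodule.finrank_add_inf_finrank_orthogonal hle
    rw [finrank_span_singleton hc0, hP] at hf
    obtain ⟨⟨v, hvo, hvd⟩, hv, hspan⟩ := finrank_eq_one_iff'.mp (by omega :
      Module.finrank ℝ ((Submodule.span ℝ {c})ᗮ ⊓ P.direction : Submodule ℝ (Euc n)) = 1)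
    have hv0 : v ≠ 0 := fun h => hv (by ext1; exact h)
    have hvv : ⟪v, v⟫ ≠ 0 := inner_self_ne_zero.mpr hv0
    have hcv : ⟪c, v⟫ = 0 := (Submodule.mem_orthogonal_singleton_iff_inner_right).mp hvo
    have hvc : ⟪v, c⟫ = 0 := by rw [real_inner_comm, hcv]
    have ha0 : ⟪v, v⟫ / (2 * ⟪c, c⟫) ≠ 0 := div_ne_zero hvv (mul_ne_zero two_ne_zero hcc)
    -- A sphere through `0` with centre `c` has equation `(y, y) = 2 (y, c)`; this multiple of `c`
    -- turns it into the equation in `circ`.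
    refine ⟨v, (⟪v, v⟫ / (2 * ⟪c, c⟫)) • c, hv0, by rw [inner_smul_right, hvc, mul_zero], ?_⟩
    have hsp : Submodule.span ℝ {v, (⟪v, v⟫ / (2 * ⟪c, c⟫)) • c} = P.direction := by
      rw [Submodule.span_insert, Submodule.span_singleton_smul_eq (IsUnit.mk0 _ ha0),
        ← Submodule.span_insert]
      apply le_antisymm
      · rw [Submodule.span_le]
        rintro y (rfl | rfl)
        · exact hvd
        · exact hcd
      · intro y hy
        obtain ⟨a, ha⟩ := hspan ⟨y - (⟪c, y⟫ / ⟪c, c⟫) • c, by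
          rw [SetLike.mem_coe, Submodule.mem_orthogonal_singleton_iff_inner_right, inner_sub_right,
            inner_smul_right, div_mul_cancel₀ _ hcc, sub_self],
          Submodule.sub_mem _ hy (Submodule.smul_mem _ _ hcd)⟩
        have ha' : a • v = y - (⟪c, y⟫ / ⟪c, c⟫) • c := congrArg Subtype.val ha
        rw [Submodule.mem_span_pair]
        exact ⟨a, ⟪c, y⟫ / ⟪c, c⟫, by rw [ha']; abel⟩
    ext y
    simp only [circ, hsp, Set.mem_inter_iff, SetLike.mem_coe, h1, Set.mem_ofPred_eq,
      mem_sphere_iff_norm, inner_smul_right, inner_smul_left, RCLike.conj_to_real]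
    refine and_congr_right fun _ => ?_
    rw [← hcr, ← sq_eq_sq₀ (norm_nonneg _) (norm_nonneg _), norm_sub_sq_real,
      ← real_inner_self_eq_norm_sq y]
    constructor
    · intro h
      field_simp
      linear_combination h
    · intro h
      field_simp at h
      linear_combination h

/-- Multiplying the equation of the circle by `c a` makes its quadratic side tend to `0`, so the
limit is orthogonal to `w`. -/
theorem mem_span_singleton_of_tendsto {α : Type*} {l : Filter α} [l.NeBot] {v w v' : Euc n}
    (h : ⟪v, w⟫ = 0) (hv : v ≠ 0) {c : α → ℝ} {d : α → Euc n} (hd : Tendsto d l (𝓝 0))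
    (hmem : ∀ᶠ a in l, d a ∈ circ v w) (hcd : Tendsto (fun a => c a • d a) l (𝓝 v')) :
    v' ∈ Submodule.span ℝ {v} := by
  have hvv : ⟪v, v⟫ ≠ 0 := inner_self_ne_zero.mpr hv
  have h1 : v' ∈ Submodule.span ℝ {v, w} := by
    refine (Submodule.closed_of_finiteDimensional _).mem_of_tendsto hcd ?_
    filter_upwards [hmem] with a ha
    exact Submodule.smul_mem _ _ ha.1
  have h2 : ⟪v', w⟫ = 0 := by
    have e1 : Tendsto (fun a => ⟪c a • d a, d a⟫ * ⟪w, w⟫) l (𝓝 (⟪v', (0 : Euc n)⟫ * ⟪w, w⟫)) :=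
      (hcd.inner hd).mul_const _
    have e2 : Tendsto (fun a => ⟪v, v⟫ * ⟪c a • d a, w⟫) l (𝓝 (⟪v, v⟫ * ⟪v', w⟫)) :=
      (hcd.inner tendsto_const_nhds).const_mul _
    have e3 := tendsto_nhds_unique_of_eventuallyEq e1 e2 (by
      filter_upwards [hmem] with a ha
      rw [inner_smul_left, inner_smul_left]
      linear_combination (starRingEnd ℝ) (c a) * ha.2)
    rw [inner_zero_right, zero_mul] at e3
    exact (mul_eq_zero.mp e3.symm).resolve_left hvv
  obtain ⟨a, b, rfl⟩ := Submodule.mem_span_pair.mp h1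
  rw [inner_add_left, inner_smul_left, inner_smul_left, h] at h2
  have hb : b • w = 0 := by
    rcases mul_eq_zero.mp (by simpa using h2 : b * ⟪w, w⟫ = 0) with hb | hb
    · rw [hb, zero_smul]
    · rw [inner_self_eq_zero.mp hb, smul_zero]
  rw [hb, add_zero]
  exact Submodule.smul_mem _ _ (Submodule.mem_span_singleton_self v)

/-- Dividing the equation of the circle by `t²` gives `(w, w) = (g, w)` in the limit. Since `g` lies
in the span of `v` and `w`, it is `w` plus a multiple of `v`. -/
theorem eq_perp_of_tendsto {v w g : Euc n} (hv : v ≠ 0) (h : ⟪v, w⟫ = 0) {γ : ℝ → Euc n}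
    (hγ : ∀ᶠ t in 𝓝[≠] 0, γ t ∈ circ v w)
    (hg : Tendsto (fun t : ℝ => (t ^ 2)⁻¹ • (γ t - t • v)) (𝓝[≠] 0) (𝓝 g)) :
    w = perp v g := by
  have hvv : ⟪v, v⟫ ≠ 0 := inner_self_ne_zero.mpr hv
  have hwv : ⟪w, v⟫ = 0 := by rw [real_inner_comm, h]
  have ht0 : ∀ᶠ t in 𝓝[≠] (0 : ℝ), t ≠ 0 := eventually_mem_nhdsWithin
  have h1 : g ∈ Submodule.span ℝ {v, w} := by
    refine (Submodule.closed_of_finiteDimensional _).mem_of_tendsto hg ?_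
    filter_upwards [hγ] with t ht
    exact Submodule.smul_mem _ _ (Submodule.sub_mem _ ht.1
      (Submodule.smul_mem _ _ (Submodule.subset_span (by simp))))
  have htt : Tendsto (fun t : ℝ => t) (𝓝[≠] 0) (𝓝 0) := nhdsWithin_le_nhds
  have h2 : ⟪v, v⟫ * ⟪w, w⟫ = ⟪v, v⟫ * ⟪g, w⟫ := by
    have e0 : Tendsto (fun t : ℝ => v + t • ((t ^ 2)⁻¹ • (γ t - t • v))) (𝓝[≠] 0)
        (𝓝 (v + (0 : ℝ) • g)) := (htt.smul hg).const_add v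
    rw [zero_smul, add_zero] at e0
    refine tendsto_nhds_unique_of_eventuallyEq ((e0.inner e0).mul_const _)
      ((hg.inner tendsto_const_nhds).const_mul _) ?_
    filter_upwards [hγ, ht0] with t ht ht0
    have e1 : v + t • ((t ^ 2)⁻¹ • (γ t - t • v)) = t⁻¹ • γ t := by
      rw [smul_smul, smul_sub, smul_smul]
      have : t * (t ^ 2)⁻¹ = t⁻¹ := by field_simp
      rw [this, inv_mul_cancel₀ ht0, one_smul]; abel
    rw [e1, inner_smul_left, inner_smul_right, inner_smul_left, inner_sub_left, inner_smul_left, h]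
    simp only [RCLike.conj_to_real]
    field_simp
    linear_combination ht.2
  have h3 : ⟪w, w⟫ = ⟪g, w⟫ := mul_left_cancel₀ hvv h2
  obtain ⟨a, b, rfl⟩ := Submodule.mem_span_pair.mp h1
  have hb : b • w = w := by
    rw [inner_add_left, inner_smul_left, inner_smul_left, h] at h3
    have : (b - 1) * ⟪w, w⟫ = 0 := by
      simp only [RCLike.conj_to_real, mul_zero, zero_add] at h3
      linear_combination -h3
    rcases mul_eq_zero.mp this with hb | hb
    · rw [sub_eq_zero.mp hb, one_smul]
    · rw [inner_self_eq_zero.mp hb, smul_zero]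
  rw [hb, add_comm, perp_add_smul hv, perp_of_inner_eq_zero h]

/-- The point with parameter `t` on `circ v w`. -/
noncomputable def circPoint (v w : Euc n) (t : ℝ) : Euc n :=
  (1 + t ^ 2 * (⟪w, w⟫ / ⟪v, v⟫))⁻¹ • (t • v + t ^ 2 • w)

theorem one_add_circ_pos (v w : Euc n) (t : ℝ) : 0 < 1 + t ^ 2 * (⟪w, w⟫ / ⟪v, v⟫) := by
  have := div_nonneg (real_inner_self_nonneg (x := w)) (real_inner_self_nonneg (x := v))
  positivity

/-- For `t ≠ 0` the point is the image of `t⁻¹ v + w` under inversion in the sphere of radius `|v|`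
about `0`; an affine line goes to a circle through `0`. -/
theorem circPoint_mem {v w : Euc n} (hv : v ≠ 0) (h : ⟪v, w⟫ = 0) (t : ℝ) :
    circPoint v w t ∈ circ v w := by
  have hvv : ⟪v, v⟫ ≠ 0 := inner_self_ne_zero.mpr hv
  have hwv : ⟪w, v⟫ = 0 := by rw [real_inner_comm, h]
  have hp := (one_add_circ_pos v w t).ne'
  have hp' : ⟪v, v⟫ + t ^ 2 * ⟪w, w⟫ ≠ 0 := by
    have := mul_ne_zero hvv hp
    rwa [mul_add, mul_one, mul_left_comm, mul_div_cancel₀ _ hvv] at this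
  refine ⟨Submodule.smul_mem _ _ (Submodule.mem_span_pair.mpr ⟨_, _, rfl⟩), ?_⟩
  simp only [circPoint, inner_smul_left, inner_smul_right, inner_add_left, inner_add_right, h, hwv,
    RCLike.conj_to_real]
  field_simp
  ring

/-- The parameter is recovered from `(y, v) = t V / N` and `V - (y, w) = V / N`, where `V = (v, v)`
and `N = 1 + t² (w, w) / V`. -/
theorem eq_circPoint {v w y : Euc n} (hv : v ≠ 0) (h : ⟪v, w⟫ = 0) (hy : y ∈ circ v w)
    (hne : ⟪v, v⟫ - ⟪y, w⟫ ≠ 0) : y = circPoint v w (⟪y, v⟫ / (⟪v, v⟫ - ⟪y, w⟫)) := by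
  have hvv : ⟪v, v⟫ ≠ 0 := inner_self_ne_zero.mpr hv
  have hwv : ⟪w, v⟫ = 0 := by rw [real_inner_comm, h]
  obtain ⟨hy1, hy2⟩ := hy
  obtain ⟨a, b, rfl⟩ := Submodule.mem_span_pair.mp hy1
  have hp := (one_add_circ_pos v w (⟪a • v + b • w, v⟫ / (⟪v, v⟫ - ⟪a • v + b • w, w⟫))).ne'
  rw [circPoint, eq_inv_smul_iff₀ hp]
  revert hy2 hne hp
  simp only [inner_smul_left, inner_smul_right, inner_add_left, inner_add_right, h, hwv,
    RCLike.conj_to_real, mul_zero, add_zero, zero_add]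
  set V := ⟪v, v⟫
  by_cases hw : w = 0
  · subst hw
    intro hne hy2 hp
    simp
    field_simp
  · have hww : ⟪w, w⟫ ≠ 0 := inner_self_ne_zero.mpr hw
    set W := ⟪w, w⟫
    intro hne hy2 hp
    have hy3 : a ^ 2 * V + b ^ 2 * W = V * b :=
      mul_right_cancel₀ hww (by linear_combination hy2)
    rw [smul_add, smul_smul, smul_smul]
    congr 2
    · field_simp
      linear_combination a * W * hy3
    · field_simp
      linear_combination (W * b - V) * hy3

theorem tendsto_circPoint {v w : Euc n} :
    Tendsto (fun t : ℝ => t⁻¹ • circPoint v w t) (𝓝[≠] 0) (𝓝 v) := by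
  have hc : Continuous fun t : ℝ => (1 + t ^ 2 * (⟪w, w⟫ / ⟪v, v⟫))⁻¹ • (v + t • w) := by
    refine Continuous.smul (Continuous.inv₀ (by fun_prop) fun t => (one_add_circ_pos v w t).ne')
      (by fun_prop)
  have := (hc.tendsto 0).mono_left (nhdsWithin_le_nhds (s := {0}ᶜ))
  simp only [ne_eq, OfNat.ofNat_ne_zero, not_false_eq_true, zero_pow, zero_mul, add_zero, inv_one,
    zero_smul, one_smul] at this
  refine this.congr' ?_
  filter_upwards [eventually_mem_nhdsWithin] with t ht
  have ht : t ≠ 0 := ht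
  rw [circPoint, smul_comm]
  congr 1
  rw [smul_add, smul_smul, smul_smul, inv_mul_cancel₀ ht, one_smul]
  congr 2
  field_simp

theorem mem_tangentConeAt_zero_of_curve {S : Set (Euc n)} {v : Euc n} {γ : ℝ → Euc n}
    (hγ : ∀ᶠ t in 𝓝[≠] 0, γ t ∈ S) (hv : Tendsto (fun t : ℝ => t⁻¹ • γ t) (𝓝[≠] 0) (𝓝 v)) :
    v ∈ tangentConeAt ℝ S 0 := by
  refine mem_tangentConeAt_of_seq (𝓝[≠] (0 : ℝ)) (fun t => t⁻¹) γ ?_ (by simpa using hγ) hv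
  have htt : Tendsto (fun t : ℝ => t) (𝓝[≠] 0) (𝓝 0) := nhdsWithin_le_nhds
  have := htt.smul hv
  rw [zero_smul] at this
  refine this.congr' ?_
  filter_upwards [eventually_mem_nhdsWithin] with t ht
  rw [smul_inv_smul₀ ht]

theorem hasDirection_circ {v w : Euc n} (hv : v ≠ 0) (h : ⟪v, w⟫ = 0) :
    HasDirection (circ v w) v :=
  ⟨hv, mem_tangentConeAt_zero_of_curve (Eventually.of_forall fun t => circPoint_mem hv h t)
    tendsto_circPoint⟩

theorem exists_eq_smul_of_hasDirection_circ {v w v' : Euc n} (hv : v ≠ 0) (h : ⟪v, w⟫ = 0)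
    (hd : HasDirection (circ v w) v') : ∃ a : ℝ, a ≠ 0 ∧ v' = a • v := by
  obtain ⟨α, l, hl, c, d, hd0, hds, hcd⟩ := exists_fun_of_mem_tangentConeAt hd.2
  have := mem_span_singleton_of_tendsto h hv hd0 (by simpa using hds) hcd
  obtain ⟨a, rfl⟩ := Submodule.mem_span_singleton.mp this
  exact ⟨a, fun ha => hd.1 (by rw [ha, zero_smul]), rfl⟩

theorem exists_eq_circ_of_hasDirection {S : Set (Euc n)} {v : Euc n} (hS : IsCircle S)
    (h0 : (0 : Euc n) ∈ S) (hd : HasDirection S v) : ∃ w : Euc n, ⟪v, w⟫ = 0 ∧ S = circ v w := by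
  obtain ⟨v', w', hv', h', rfl⟩ := exists_eq_circ hS h0
  obtain ⟨a, ha, rfl⟩ := exists_eq_smul_of_hasDirection_circ hv' h' hd
  refine ⟨a ^ 2 • w', ?_, (circ_smul ha _ _).symm⟩
  rw [inner_smul_left, inner_smul_right, h']
  simp

end Circles

/-! ### The bundle is read off from the quadratic part of a rectifying germ. -/

section QuadraticPart

variable {n : ℕ}

/-- The germ `Φ` fixes the origin, has identity differential and quadratic part `G` there, and its
inverse straightens `B`. -/
structure StraightensWith (Φ : OpenPartialHomeomorph (Euc n) (Euc n))
    (G : QuadraticMap ℝ (Euc n) (Euc n)) (B : Set (Set (Euc n))) : Prop where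
  isDiffeoGerm : IsDiffeoGerm Φ
  map_zero : Φ 0 = 0
  straightens : Straightens Φ.symm B
  isLittleO : (fun x => Φ x - x - G x) =o[𝓝 (0 : Euc n)] fun x => ‖x‖ ^ 2

theorem tendsto_smul_nhds_zero (v : Euc n) : Tendsto (fun t : ℝ => t • v) (𝓝 0) (𝓝 0) := by
  have : Continuous fun t : ℝ => t • v := by fun_prop
  simpa using this.tendsto 0

theorem tendsto_quadraticPart {f : Euc n → Euc n} {G : QuadraticMap ℝ (Euc n) (Euc n)}
    (ho : (fun x => f x - x - G x) =o[𝓝 (0 : Euc n)] fun x => ‖x‖ ^ 2) (v : Euc n) :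
    Tendsto (fun t : ℝ => (t ^ 2)⁻¹ • (f (t • v) - t • v)) (𝓝[≠] 0) (𝓝 (G v)) := by
  have h1 : (fun t : ℝ => f (t • v) - t • v - G (t • v)) =o[𝓝[≠] 0] fun t : ℝ => t ^ 2 := by
    refine ((ho.comp_tendsto (tendsto_smul_nhds_zero v)).mono nhdsWithin_le_nhds).trans_isBigO ?_
    refine IsBigO.of_bound (‖v‖ ^ 2) (Eventually.of_forall fun t => ?_)
    simp [norm_smul, mul_pow, mul_comm]
  have h2 := h1.tendsto_inv_smul_nhds_zero.add_const (G v)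
  rw [zero_add] at h2
  refine h2.congr' ?_
  filter_upwards [eventually_mem_nhdsWithin] with t ht
  have ht : t ≠ 0 := ht
  rw [G.map_smul, smul_sub, smul_smul]
  have : (t ^ 2)⁻¹ * (t * t) = 1 := by field_simp
  rw [this, one_smul, sub_add_cancel]

theorem tendsto_linearPart {f : Euc n → Euc n} {v g : Euc n}
    (h : Tendsto (fun t : ℝ => (t ^ 2)⁻¹ • (f (t • v) - t • v)) (𝓝[≠] 0) (𝓝 g)) :
    Tendsto (fun t : ℝ => t⁻¹ • f (t • v)) (𝓝[≠] 0) (𝓝 v) := by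
  have htt : Tendsto (fun t : ℝ => t) (𝓝[≠] 0) (𝓝 0) := nhdsWithin_le_nhds
  have := (htt.smul h).add_const v
  rw [zero_smul, zero_add] at this
  refine this.congr' ?_
  filter_upwards [eventually_mem_nhdsWithin] with t ht
  have ht : t ≠ 0 := ht
  rw [smul_smul, smul_sub, smul_smul]
  have : t * (t ^ 2)⁻¹ = t⁻¹ := by field_simp
  rw [this, inv_mul_cancel₀ ht, one_smul, sub_add_cancel]

variable {Φ : OpenPartialHomeomorph (Euc n) (Euc n)} {G : QuadraticMap ℝ (Euc n) (Euc n)}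
  {B : Set (Set (Euc n))}

theorem StraightensWith.tendsto_zero (h : StraightensWith Φ G B) (v : Euc n) :
    Tendsto (fun t : ℝ => Φ (t • v)) (𝓝 0) (𝓝 0) := by
  have := (Φ.continuousAt h.isDiffeoGerm.zero_mem_source).tendsto.comp (tendsto_smul_nhds_zero v)
  rwa [h.map_zero] at this

/-- `Φ` has identity differential, so the line that it sends into `S` is tangent to `S` at `0`,
hence is the line of `v`. -/
theorem StraightensWith.eventually_mem (h : StraightensWith Φ G B) (hB : IsSimpleBundle B)
    {S : Set (Euc n)} (hS : S ∈ B) {v : Euc n} (hd : HasDirection S v) :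
    ∀ᶠ t in 𝓝 (0 : ℝ), Φ (t • v) ∈ S := by
  obtain ⟨L, hL, hiff⟩ := h.straightens S hS
  have hsymm0 : Φ.symm 0 = 0 := by
    conv_lhs => rw [← h.map_zero]
    exact Φ.left_inv h.isDiffeoGerm.zero_mem_source
  have h0 : (0 : Euc n) ∈ L := by
    have := hiff.self_of_nhds.mp (hB.zero_mem S hS)
    rwa [hsymm0] at this
  have hdir : ∀ y, y ∈ L ↔ y ∈ L.direction := fun y => by
    rw [← AffineSubspace.vsub_right_mem_direction_iff_mem h0]; simp
  have hmem : ∀ u ∈ L.direction, ∀ᶠ t in 𝓝 (0 : ℝ), Φ (t • u) ∈ S := by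
    intro u hu
    filter_upwards [(h.tendsto_zero u).eventually hiff, (tendsto_smul_nhds_zero u).eventually
      (Φ.open_source.mem_nhds h.isDiffeoGerm.zero_mem_source)] with t ht hs
    rw [ht, Φ.left_inv hs, hdir]
    exact Submodule.smul_mem _ _ hu
  obtain ⟨u, hu, -⟩ := finrank_eq_one_iff'.mp hL
  have hu0 : (u : Euc n) ≠ 0 := by simpa using hu
  obtain ⟨w, hw, rfl⟩ := exists_eq_circ_of_hasDirection (hB.isCircle S hS) (hB.zero_mem S hS) hd
  have hu' : HasDirection (circ v w) (u : Euc n) := ⟨hu0, mem_tangentConeAt_zero_of_curve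
    ((hmem u u.2).filter_mono nhdsWithin_le_nhds)
    (tendsto_linearPart (tendsto_quadraticPart h.isLittleO u))⟩
  obtain ⟨a, ha, hav⟩ := exists_eq_smul_of_hasDirection_circ hd.1 hw hu'
  apply hmem
  have : v = a⁻¹ • (u : Euc n) := by rw [hav, inv_smul_smul₀ ha]
  rw [this]
  exact Submodule.smul_mem _ _ u.2

theorem StraightensWith.eq_circ (h : StraightensWith Φ G B) (hB : IsSimpleBundle B)
    {S : Set (Euc n)} (hS : S ∈ B) {v : Euc n} (hd : HasDirection S v) :
    S = circ v (perp v (G v)) := by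
  have hm := h.eventually_mem hB hS hd
  obtain ⟨w, hw, rfl⟩ := exists_eq_circ_of_hasDirection (hB.isCircle S hS) (hB.zero_mem S hS) hd
  rw [eq_perp_of_tendsto hd.1 hw (hm.filter_mono nhdsWithin_le_nhds)
    (tendsto_quadraticPart h.isLittleO v)]

theorem StraightensWith.eq_setOf (h : StraightensWith Φ G B) (hB : IsCompleteBundle B) :
    B = {S | ∃ v : Euc n, v ≠ 0 ∧ S = circ v (perp v (G v))} := by
  ext S
  constructor
  · intro hS
    obtain ⟨v, w, hv, hw, hSe⟩ := exists_eq_circ (hB.isCircle S hS) (hB.zero_mem S hS)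
    exact ⟨v, hv, h.eq_circ hB.toIsSimpleBundle hS (hSe ▸ hasDirection_circ hv hw)⟩
  · rintro ⟨v, hv, rfl⟩
    obtain ⟨S, ⟨hS, hd⟩, -⟩ := hB.existsUnique v hv
    rwa [← h.eq_circ hB.toIsSimpleBundle hS hd]

theorem StraightensWith.perp_eq {Φ' : OpenPartialHomeomorph (Euc n) (Euc n)}
    {G' : QuadraticMap ℝ (Euc n) (Euc n)} (h : StraightensWith Φ G B)
    (h' : StraightensWith Φ' G' B) (hB : IsCompleteBundle B) {v : Euc n} (hv : v ≠ 0) :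
    perp v (G v) = perp v (G' v) := by
  obtain ⟨S, ⟨hS, hd⟩, -⟩ := hB.existsUnique v hv
  have hm := h.eventually_mem hB.toIsSimpleBundle hS hd
  have hm' := h'.eventually_mem hB.toIsSimpleBundle hS hd
  obtain ⟨w, hw, rfl⟩ := exists_eq_circ_of_hasDirection (hB.isCircle S hS) (hB.zero_mem S hS) hd
  rw [← eq_perp_of_tendsto hv hw (hm.filter_mono nhdsWithin_le_nhds)
    (tendsto_quadraticPart h.isLittleO v), ← eq_perp_of_tendsto hv hw
    (hm'.filter_mono nhdsWithin_le_nhds) (tendsto_quadraticPart h'.isLittleO v)]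

end QuadraticPart

/-! ### Comparison of Taylor coefficients along a circle. -/

section Coefficients

variable {n : ℕ}

theorem coeffs_eq_zero_of_isLittleO {a b c : Euc n}
    (h : (fun t : ℝ => a + t • b + t ^ 2 • c) =o[𝓝[≠] 0] fun t : ℝ => t ^ 2) :
    a = 0 ∧ b = 0 ∧ c = 0 := by
  have htt : Tendsto (fun t : ℝ => t) (𝓝[≠] 0) (𝓝 0) := nhdsWithin_le_nhds
  have hne : ∀ᶠ t in 𝓝[≠] (0 : ℝ), t ≠ 0 := eventually_mem_nhdsWithin
  have lim : ∀ x y : Euc n, Tendsto (fun t : ℝ => x + t • y) (𝓝[≠] 0) (𝓝 x) := by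
    intro x y
    simpa using (htt.smul_const y).const_add x
  have h0 := h.tendsto_inv_smul_nhds_zero
  have ha : a = 0 := by
    refine tendsto_nhds_unique (lim a (b + (0 : ℝ) • c)) ?_
    have h1 := (htt.smul (htt.smul h0)).sub (htt.smul (htt.smul_const c))
    simp only [zero_smul, smul_zero, sub_zero] at h1
    refine h1.congr' ?_
    filter_upwards [hne] with t ht
    have : t * t * (t ^ 2)⁻¹ = 1 := by field_simp
    rw [smul_smul, smul_smul, this]
    module
  subst ha
  have hb : b = 0 := by
    refine tendsto_nhds_unique (lim b c) ?_
    have h1 := htt.smul h0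
    simp only [zero_smul] at h1
    refine h1.congr' ?_
    filter_upwards [hne] with t ht
    have e : t * (t ^ 2)⁻¹ = t⁻¹ := by field_simp
    have e' : t⁻¹ * t = 1 := inv_mul_cancel₀ ht
    rw [smul_smul, e, zero_add, smul_add, smul_smul, e', smul_smul, pow_two, ← mul_assoc, e',
      one_smul, one_mul]
  subst hb
  refine ⟨rfl, rfl, tendsto_nhds_unique tendsto_const_nhds (h0.congr' ?_)⟩
  filter_upwards [hne] with t ht
  rw [smul_zero, zero_add, zero_add, inv_smul_smul₀ (pow_ne_zero 2 ht)]

theorem isLittleO_smul_line {f : Euc n → Euc n} {k : ℕ}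
    (h : f =o[𝓝 (0 : Euc n)] fun x => ‖x‖ ^ k) (v : Euc n) :
    (fun t : ℝ => f (t • v)) =o[𝓝[≠] 0] fun t : ℝ => t ^ k := by
  refine ((h.comp_tendsto (tendsto_smul_nhds_zero v)).mono nhdsWithin_le_nhds).trans_isBigO ?_
  refine IsBigO.of_bound (‖v‖ ^ k) (Eventually.of_forall fun t => ?_)
  simp [norm_smul, mul_pow, mul_comm]

theorem isBigO_pow_of_le {j k : ℕ} (hjk : j ≤ k) :
    (fun t : ℝ => t ^ k) =O[𝓝[≠] 0] fun t : ℝ => t ^ j := by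
  have h := ((continuous_pow (M := ℝ) (k - j)).tendsto 0).mono_left
    (nhdsWithin_le_nhds (s := ({0}ᶜ : Set ℝ)))
  have := (isBigO_refl (fun t : ℝ => t ^ j) (𝓝[≠] 0)).mul (h.isBigO_one ℝ)
  simpa only [← pow_add, Nat.add_sub_cancel' hjk, mul_one] using this

theorem smul_pow_isLittleO {j k : ℕ} (hjk : j < k) (x : Euc n) :
    (fun t : ℝ => t ^ k • x) =o[𝓝[≠] 0] fun t : ℝ => t ^ j := by
  have h : (fun t : ℝ => t ^ k • x) =O[𝓝[≠] 0] fun t : ℝ => t ^ k :=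
    IsBigO.of_bound ‖x‖ (Eventually.of_forall fun t => by simp [norm_smul, mul_comm])
  exact h.trans_isLittleO ((isLittleO_pow_pow hjk).mono nhdsWithin_le_nhds)

theorem exists_taylor_of_quadraticPart {f : Euc n → Euc n} (hf : ContDiffAt ℝ ∞ f 0)
    {G : QuadraticMap ℝ (Euc n) (Euc n)}
    (ho : (fun x => f x - x - G x) =o[𝓝 (0 : Euc n)] fun x => ‖x‖ ^ 2) :
    ∃ T F : Euc n → Euc n, IsForm 3 T ∧ IsForm 4 F ∧ ∀ x,
      (fun t : ℝ => f (t • x) - t • x - t ^ 2 • G x - t ^ 3 • T x - t ^ 4 • F x)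
        =o[𝓝[≠] 0] fun t : ℝ => t ^ 4 := by
  obtain ⟨p, hp, hr⟩ := exists_taylor_forms 4 hf
  refine ⟨p 3, p 4, hp 3, hp 4, fun x => ?_⟩
  have h4 := isLittleO_smul_line hr x
  simp only [Finset.sum_range_succ, Finset.sum_range_zero, (hp _).map_smul] at h4
  have h2 := isLittleO_smul_line ho x
  have h3 := (smul_pow_isLittleO (by norm_num : 2 < 3) (p 3 x)).add
    (smul_pow_isLittleO (by norm_num : 2 < 4) (p 4 x))
  have h4' := h4.trans_isBigO (isBigO_pow_of_le (by norm_num : 2 ≤ 4))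
  obtain ⟨e0, e1, e2⟩ := coeffs_eq_zero_of_isLittleO (a := p 0 x) (b := p 1 x - x)
    (c := p 2 x - G x) (((h2.sub h4').sub h3).congr_left fun t => by
      rw [G.map_smul]
      module)
  refine h4.congr_left fun t => ?_
  rw [e0, sub_eq_zero.mp e1, sub_eq_zero.mp e2]
  module

/-- The equation of the circle with denominators cleared: polynomial in `v`, `g` and `y`, so it can
be continued to complex vectors. -/
theorem circ_equation {v g y : Euc n} (hv : v ≠ 0) (hy : y ∈ circ v (perp v g)) :
    ⟪y, y⟫ * (⟪v, v⟫ * ⟪g, g⟫ - ⟪v, g⟫ ^ 2) =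
      ⟪v, v⟫ * (⟪v, v⟫ * ⟪y, g⟫ - ⟪v, g⟫ * ⟪y, v⟫) := by
  have hvv : ⟪v, v⟫ ≠ 0 := inner_self_ne_zero.mpr hv
  have h := hy.2
  simp only [perp, inner_sub_left, inner_sub_right, inner_smul_left, inner_smul_right,
    RCLike.conj_to_real, real_inner_comm v g] at h
  field_simp at h
  linear_combination h

/-- The 4-jet is substituted into `circ_equation`. The terms of order `t` and `t²` cancel
identically, and the two displayed identities are those of order `t³` and `t⁴`. The span condition
says that the curve stays in the plane of `v` and `g`. -/
theorem taylor_coeffs_of_circ {v g T F : Euc n} (hv : v ≠ 0) {y : ℝ → Euc n}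
    (hy : ∀ᶠ t in 𝓝[≠] 0, y t ∈ circ v (perp v g))
    (ho : (fun t : ℝ => y t - t • v - t ^ 2 • g - t ^ 3 • T - t ^ 4 • F)
      =o[𝓝[≠] 0] fun t : ℝ => t ^ 4) :
    (∃ a b : ℝ, T = a • v + b • g) ∧
    2 * ⟪v, g⟫ * (⟪v, v⟫ * ⟪g, g⟫ - ⟪v, g⟫ ^ 2) =
      ⟪v, v⟫ * (⟪v, v⟫ * ⟪T, g⟫ - ⟪v, g⟫ * ⟪T, v⟫) ∧
    (⟪g, g⟫ + 2 * ⟪v, T⟫) * (⟪v, v⟫ * ⟪g, g⟫ - ⟪v, g⟫ ^ 2) =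
      ⟪v, v⟫ * (⟪v, v⟫ * ⟪F, g⟫ - ⟪v, g⟫ * ⟪F, v⟫) := by
  have htt : Tendsto (fun t : ℝ => t) (𝓝[≠] 0) (𝓝 0) := nhdsWithin_le_nhds
  have hne : ∀ᶠ t in 𝓝[≠] (0 : ℝ), t ≠ 0 := eventually_mem_nhdsWithin
  obtain ⟨z, hz, hyz⟩ : ∃ z : ℝ → Euc n, Tendsto z (𝓝[≠] 0) (𝓝 F) ∧
      ∀ t, t ≠ 0 → y t = t • v + t ^ 2 • g + t ^ 3 • T + t ^ 4 • z t := by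
    refine ⟨fun t => (t ^ 4)⁻¹ • (y t - t • v - t ^ 2 • g - t ^ 3 • T - t ^ 4 • F) + F, ?_, ?_⟩
    · simpa using ho.tendsto_inv_smul_nhds_zero.add_const F
    · intro t ht
      rw [smul_add, smul_inv_smul₀ (pow_ne_zero 4 ht)]
      abel
  have hspan : ∃ a b : ℝ, T = a • v + b • g := by
    have h1 : T ∈ Submodule.span ℝ {v, g} := by
      have h2 : Tendsto (fun t => T + t • z t) (𝓝[≠] 0) (𝓝 (T + (0 : ℝ) • F)) :=
        (htt.smul hz).const_add T
      rw [zero_smul, add_zero] at h2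
      refine (Submodule.closed_of_finiteDimensional _).mem_of_tendsto h2 ?_
      filter_upwards [hy, hne] with t ht ht0
      obtain ⟨a, b, hab⟩ := Submodule.mem_span_pair.mp ht.1
      have h3 : T + t • z t = (t ^ 3)⁻¹ • (y t - t • v - t ^ 2 • g) := by
        rw [eq_inv_smul_iff₀ (pow_ne_zero 3 ht0), hyz t ht0]
        module
      rw [h3, ← hab, perp]
      refine Submodule.smul_mem _ _ (Submodule.mem_span_pair.mpr
        ⟨a - b * (⟪v, g⟫ / ⟪v, v⟫) - t, b - t ^ 2, by module⟩)
    obtain ⟨a, b, hab⟩ := Submodule.mem_span_pair.mp h1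
    exact ⟨a, b, hab.symm⟩
  have hN : Tendsto (fun t : ℝ => 2 * ⟪v, z t⟫ + 2 * ⟪g, T⟫ + t * (⟪T, T⟫ + 2 * ⟪g, z t⟫)
      + t ^ 2 * (2 * ⟪T, z t⟫) + t ^ 3 * ⟪z t, z t⟫) (𝓝[≠] 0)
      (𝓝 (2 * ⟪v, F⟫ + 2 * ⟪g, T⟫ + 0 * (⟪T, T⟫ + 2 * ⟪g, F⟫)
      + 0 ^ 2 * (2 * ⟪T, F⟫) + 0 ^ 3 * ⟪F, F⟫)) := by
    have hc : ∀ x : Euc n, Tendsto (fun t => ⟪x, z t⟫) (𝓝[≠] 0) (𝓝 ⟪x, F⟫) :=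
      fun x => tendsto_const_nhds.inner hz
    exact (((((hc v).const_mul 2).add_const _).add (htt.mul (((hc g).const_mul 2).const_add _))).add
      ((htt.pow 2).mul ((hc T).const_mul 2))).add ((htt.pow 3).mul (hz.inner hz))
  -- The part of `(y, y)` from order `t⁴` on, divided by `t⁴`, apart from `(g, g) + 2 (v, T)`, which
  -- belongs to order `t⁴` of the whole equation only after a shift by one.
  set R : ℝ → ℝ := fun t : ℝ => 2 * ⟪v, z t⟫ + 2 * ⟪g, T⟫ + t * (⟪T, T⟫ + 2 * ⟪g, z t⟫)
      + t ^ 2 * (2 * ⟪T, z t⟫) + t ^ 3 * ⟪z t, z t⟫ with hR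
  set D := ⟪v, v⟫ * ⟪g, g⟫ - ⟪v, g⟫ ^ 2 with hD
  have hA : Tendsto (fun t => ⟪v, v⟫ * ⟪z t, g⟫ - ⟪v, g⟫ * ⟪z t, v⟫) (𝓝[≠] 0)
      (𝓝 (⟪v, v⟫ * ⟪F, g⟫ - ⟪v, g⟫ * ⟪F, v⟫)) :=
    ((hz.inner tendsto_const_nhds).const_mul _).sub ((hz.inner tendsto_const_nhds).const_mul _)
  have key : ∀ᶠ t in 𝓝[≠] (0 : ℝ),
      2 * ⟪v, g⟫ * D + t * ((⟪g, g⟫ + 2 * ⟪v, T⟫) * D + t * (R t * D)) =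
      ⟪v, v⟫ * (⟪v, v⟫ * ⟪T, g⟫ - ⟪v, g⟫ * ⟪T, v⟫) +
        t * (⟪v, v⟫ * (⟪v, v⟫ * ⟪z t, g⟫ - ⟪v, g⟫ * ⟪z t, v⟫)) := by
    filter_upwards [hy, hne] with t ht ht0
    have h := circ_equation hv ht
    rw [hyz t ht0] at h
    simp only [inner_add_left, inner_add_right, inner_smul_left, inner_smul_right,
      RCLike.conj_to_real] at h
    refine mul_left_cancel₀ (pow_ne_zero 3 ht0) ?_
    rw [hR]
    simp only [hD]
    simp only [real_inner_comm v g, real_inner_comm v T, real_inner_comm g T, real_inner_comm v (z t),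
      real_inner_comm g (z t), real_inner_comm T (z t)] at h ⊢
    linear_combination h
  have hb : 2 * ⟪v, g⟫ * D = ⟪v, v⟫ * (⟪v, v⟫ * ⟪T, g⟫ - ⟪v, g⟫ * ⟪T, v⟫) := by
    have h1 := ((htt.mul ((htt.mul (hN.mul_const D)).const_add
      ((⟪g, g⟫ + 2 * ⟪v, T⟫) * D))).const_add (2 * ⟪v, g⟫ * D))
    have h2 := (htt.mul (hA.const_mul ⟪v, v⟫)).const_add
      (⟪v, v⟫ * (⟪v, v⟫ * ⟪T, g⟫ - ⟪v, g⟫ * ⟪T, v⟫))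
    simpa using tendsto_nhds_unique_of_eventuallyEq h1 h2 key
  refine ⟨hspan, hb, ?_⟩
  have h1 := (htt.mul (hN.mul_const D)).const_add ((⟪g, g⟫ + 2 * ⟪v, T⟫) * D)
  have h2 := hA.const_mul ⟪v, v⟫
  have h3 := tendsto_nhds_unique_of_eventuallyEq h1 h2 (by
    filter_upwards [key, hne] with t ht ht0
    rw [hb] at ht
    exact mul_left_cancel₀ ht0 (add_left_cancel ht))
  simpa using h3

end Coefficients

/-! ### Passage to complex vectors and necessity of admissibility. -/

section Complexification

variable {n : ℕ}

/-- The inclusion `ℝⁿ ⊂ ℂⁿ` as a real linear map. -/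
noncomputable def toComplexLinearMap (n : ℕ) : Euc n →ₗ[ℝ] (Fin n → ℂ) where
  toFun := toComplex
  map_add' x y := by ext i; simp [toComplex]
  map_smul' a x := by ext i; simp [toComplex]

theorem toComplex_add (x y : Euc n) : toComplex (x + y) = toComplex x + toComplex y :=
  (toComplexLinearMap n).map_add x y

theorem toComplex_sub (x y : Euc n) : toComplex (x - y) = toComplex x - toComplex y :=
  (toComplexLinearMap n).map_sub x y

theorem toComplex_smul (a : ℝ) (x : Euc n) : toComplex (a • x) = (a : ℂ) • toComplex x := by
  ext i; simp [toComplex]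

theorem toComplex_injective : Function.Injective (toComplex : Euc n → Fin n → ℂ) := by
  intro x y h
  ext i
  exact Complex.ofReal_injective (congrFun h i)

theorem toComplex_dotProduct (x y : Euc n) : toComplex x ⬝ᵥ toComplex y = (⟪x, y⟫ : ℂ) := by
  simp [dotProduct, toComplex, PiLp.inner_apply, mul_comm]

theorem exists_eq_toComplex_add (z : Fin n → ℂ) :
    ∃ u v : Euc n, z = toComplex u + Complex.I • toComplex v := by
  refine ⟨WithLp.toLp 2 fun i => (z i).re, WithLp.toLp 2 fun i => (z i).im, ?_⟩
  ext i
  simp [toComplex, mul_comm Complex.I, Complex.re_add_im]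

theorem dotProduct_self_add_I_smul (u v : Euc n) :
    (toComplex u + Complex.I • toComplex v) ⬝ᵥ (toComplex u + Complex.I • toComplex v) = 0 ↔
      ⟪u, u⟫ = ⟪v, v⟫ ∧ ⟪u, v⟫ = 0 := by
  have key : (toComplex u + Complex.I • toComplex v) ⬝ᵥ (toComplex u + Complex.I • toComplex v) =
      ((⟪u, u⟫ - ⟪v, v⟫ : ℝ) : ℂ) + (2 * ⟪u, v⟫ : ℝ) * Complex.I := by
    simp only [add_dotProduct, dotProduct_add, smul_dotProduct, dotProduct_smul,
      toComplex_dotProduct, smul_eq_mul, real_inner_comm u v]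
    push_cast
    linear_combination (⟪v, v⟫ : ℂ) * Complex.I_mul_I
  have aux : ∀ a b : ℝ, (a : ℂ) + b * Complex.I = 0 ↔ a = 0 ∧ b = 0 := by
    intro a b
    simp [Complex.ext_iff]
  rw [key, aux, sub_eq_zero, mul_eq_zero, or_iff_right (two_ne_zero' ℝ)]

/-- `Γ` is the complexification of the real quadratic map `G`. -/
def IsComplexification (Γ : QuadMap n) (G : QuadraticMap ℝ (Euc n) (Euc n)) : Prop :=
  ∀ x, Γ (toComplex x) = toComplex (G x)

/-- The value at `u + s v` of the complexification of `G`. -/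
noncomputable def complexValue (G : QuadraticMap ℝ (Euc n) (Euc n)) (u v : Euc n) (s : ℂ) :
    Fin n → ℂ :=
  toComplex (G u) + s • toComplex (QuadraticMap.polar G u v) + s ^ 2 • toComplex (G v)

theorem IsComplexification.apply_add_smul {Γ : QuadMap n} {G : QuadraticMap ℝ (Euc n) (Euc n)}
    (h : IsComplexification Γ G) (u v : Euc n) (s : ℂ) :
    Γ (toComplex u + s • toComplex v) = complexValue G u v s := by
  have h1 : QuadraticMap.polar Γ (toComplex u) (toComplex v) =
      toComplex (QuadraticMap.polar G u v) := by
    simp only [QuadraticMap.polar, ← toComplex_add, h _, toComplex_sub]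
  rw [QuadraticMap.map_add Γ, QuadraticMap.polar_smul_right, h1, QuadraticMap.map_smul, h, h,
    complexValue]
  module

theorem toComplex_quadraticMap_add_smul (G : QuadraticMap ℝ (Euc n) (Euc n)) (u v : Euc n)
    (s : ℝ) : toComplex (G (u + s • v)) = complexValue G u v s := by
  rw [QuadraticMap.map_add G, QuadraticMap.polar_smul_right, QuadraticMap.map_smul, complexValue]
  simp only [toComplex_add, toComplex_smul]
  push_cast
  module

/-- Every quadratic map `ℝⁿ → ℝⁿ` has a complexification. -/
theorem exists_isComplexification (G : QuadraticMap ℝ (Euc n) (Euc n)) :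
    ∃ Γ : QuadMap n, IsComplexification Γ G := by
  let e : Fin n → Euc n := fun i => EuclideanSpace.single i 1
  let B : (Fin n → ℂ) →ₗ[ℂ] (Fin n → ℂ) →ₗ[ℂ] (Fin n → ℂ) :=
    LinearMap.mk₂ ℂ (fun z w => ∑ i, ∑ j, (z i * w j) • toComplex ((1 / 2 : ℝ) • G.polarBilin (e i) (e j)))
      (fun z z' w => by simp [add_mul, add_smul, Finset.sum_add_distrib])
      (fun c z w => by simp [Finset.smul_sum, smul_smul, mul_assoc])
      (fun z w w' => by simp [mul_add, add_smul, Finset.sum_add_distrib])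
      (fun c z w => by simp [Finset.smul_sum, smul_smul, mul_left_comm])
  refine ⟨LinearMap.BilinMap.toQuadraticMap B, fun x => ?_⟩
  have hx : x = ∑ i, x i • e i := by
    ext k
    simp [e, Pi.single_apply]
  have hG : G x = (1 / 2 : ℝ) • G.polarBilin x x := by
    simp [QuadraticMap.polar_self, ← Nat.cast_smul_eq_nsmul ℝ, smul_smul]
  have hP : G.polarBilin x x = ∑ i, ∑ j, (x i * x j) • G.polarBilin (e i) (e j) := by
    conv_lhs => rw [hx]
    simp only [map_sum, LinearMap.sum_apply, map_smul, LinearMap.smul_apply, Finset.smul_sum,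
      smul_smul]
    rw [Finset.sum_comm]
    simp only [mul_comm]
  rw [LinearMap.BilinMap.toQuadraticMap_apply, hG, hP, Finset.smul_sum]
  change _ = toComplexLinearMap n _
  simp only [B, LinearMap.mk₂_apply, map_sum, Finset.smul_sum]
  refine Finset.sum_congr rfl fun i _ => Finset.sum_congr rfl fun j _ => ?_
  change _ = toComplex _
  rw [smul_comm, toComplex_smul (x i * x j)]
  simp [toComplex]

theorem exists_isComplexification_of_real {Γ : QuadMap n}
    (h : ∀ x : Euc n, ∃ y : Euc n, Γ (toComplex x) = toComplex y) :
    ∃ G : QuadraticMap ℝ (Euc n) (Euc n), IsComplexification Γ G := by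
  choose g hg using h
  have hpol : ∀ x y, toComplex (QuadraticMap.polar g x y) =
      QuadraticMap.polar Γ (toComplex x) (toComplex y) := by
    intro x y
    simp only [QuadraticMap.polar, ← toComplex_add, hg, toComplex_sub]
  refine ⟨QuadraticMap.ofPolar g ?_ ?_ ?_, hg⟩
  · intro a x
    apply toComplex_injective
    rw [← hg, toComplex_smul, toComplex_smul, QuadraticMap.map_smul, hg]
    push_cast; rfl
  · intro x y z
    apply toComplex_injective
    simp only [toComplex_add, hpol, QuadraticMap.polar_add_left]
  · intro a x y
    apply toComplex_injective
    simp only [toComplex_smul, hpol, QuadraticMap.polar_smul_left]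

/-- This is what the planewise definition is for: on a real line a form is polynomial in `s`, which
can then be given complex values. -/
theorem IsForm.exists_polynomial {j : ℕ} {p : Euc n → Euc n} (hp : IsForm j p) (u v : Euc n) :
    ∃ P : Fin n → Polynomial ℂ, ∀ s : ℝ, (fun i => (P i).eval (s : ℂ)) =
      toComplex (p (u + s • v)) := by
  obtain ⟨c, hc⟩ := hp u v
  refine ⟨fun i => ∑ k ∈ Finset.range (j + 1), Polynomial.C (c k i : ℂ) * Polynomial.X ^ k,
    fun s => ?_⟩
  have := hc 1 s
  simp only [one_smul, one_pow, one_mul] at this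
  rw [this]
  ext i
  simp only [Polynomial.eval_finsetSum, Polynomial.eval_mul, Polynomial.eval_C,
    Polynomial.eval_pow, Polynomial.eval_X, toComplex, WithLp.ofLp_sum, Finset.sum_apply,
    WithLp.ofLp_smul, Pi.smul_apply, smul_eq_mul, Complex.ofReal_sum, Complex.ofReal_mul,
    Complex.ofReal_pow]
  exact Finset.sum_congr rfl fun k _ => mul_comm _ _

theorem eval_dotProduct (P Q : Fin n → Polynomial ℂ) (s : ℂ) :
    (P ⬝ᵥ Q).eval s = (fun i => (P i).eval s) ⬝ᵥ (fun i => (Q i).eval s) := by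
  simp [dotProduct, Polynomial.eval_finsetSum]

theorem polynomial_eq_of_eval_ofReal {P Q : Polynomial ℂ}
    (h : ∀ s : ℝ, P.eval (s : ℂ) = Q.eval (s : ℂ)) : P = Q := by
  refine Polynomial.eq_of_infinite_eval_eq P Q (Set.Infinite.mono ?_
    (Set.infinite_range_of_injective Complex.ofReal_injective))
  rintro _ ⟨s, rfl⟩
  exact h s

/-- The Taylor identities along the real line `u + s v` are continued to `s = i`, where `u + s v`
becomes isotropic. -/
theorem StraightensWith.isotropic {Φ : OpenPartialHomeomorph (Euc n) (Euc n)}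
    {G : QuadraticMap ℝ (Euc n) (Euc n)} {B : Set (Set (Euc n))} (h : StraightensWith Φ G B)
    (hB : IsCompleteBundle B) {u v : Euc n} (huv : ⟪u, u⟫ = ⟪v, v⟫) (ho : ⟪u, v⟫ = 0) :
    (toComplex u + Complex.I • toComplex v) ⬝ᵥ complexValue G u v Complex.I = 0 ∧
    complexValue G u v Complex.I ⬝ᵥ complexValue G u v Complex.I = 0 := by
  by_cases hu : u = 0
  · have hv : v = 0 := by rw [hu, inner_zero_left] at huv; exact inner_self_eq_zero.mp huv.symm
    subst hu hv
    have : toComplex (0 : Euc n) = 0 := (toComplexLinearMap n).map_zero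
    simp [complexValue, this, QuadraticMap.polar]
  have hc : ((⟪u, u⟫ : ℝ) : ℂ) ≠ 0 := by
    simpa using hu
  have hcd : ContDiffAt ℝ ∞ Φ 0 := h.isDiffeoGerm.contDiffOn.contDiffAt
    (Φ.open_source.mem_nhds h.isDiffeoGerm.zero_mem_source)
  obtain ⟨T, F, hT, hF, hTF⟩ := exists_taylor_of_quadraticPart hcd h.isLittleO
  obtain ⟨PT, hPT⟩ := hT.exists_polynomial u v
  obtain ⟨PF, hPF⟩ := hF.exists_polynomial u v
  have hne : ∀ s : ℝ, u + s • v ≠ 0 := by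
    intro s hs
    have h1 : ⟪u, u + s • v⟫ = 0 := by rw [hs, inner_zero_right]
    rw [inner_add_right, inner_smul_right, ho, mul_zero, add_zero] at h1
    exact hu (inner_self_eq_zero.mp h1)
  have hmem : ∀ s : ℝ, ∀ᶠ t in 𝓝[≠] (0 : ℝ), Φ (t • (u + s • v)) ∈
      circ (u + s • v) (perp (u + s • v) (G (u + s • v))) := fun s => by
    obtain ⟨S, ⟨hS, hd⟩, -⟩ := hB.existsUnique (u + s • v) (hne s)
    have hm := h.eventually_mem hB.toIsSimpleBundle hS hd
    rw [h.eq_circ hB.toIsSimpleBundle hS hd] at hm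
    exact hm.filter_mono nhdsWithin_le_nhds
  have hcoef := fun s : ℝ => taylor_coeffs_of_circ (hne s) (hmem s) (hTF (u + s • v))
  let X : Fin n → Polynomial ℂ := fun i => Polynomial.C (toComplex u i) +
    Polynomial.X * Polynomial.C (toComplex v i)
  let g : Fin n → Polynomial ℂ := fun i => Polynomial.C (toComplex (G u) i) +
    Polynomial.X * Polynomial.C (toComplex (QuadraticMap.polar G u v) i) +
    Polynomial.X ^ 2 * Polynomial.C (toComplex (G v) i)
  -- A constant test vector; its product with `X` at `s = i` is `(u, u) ≠ 0`.
  let z : Fin n → Polynomial ℂ := fun i => Polynomial.C (toComplex u i)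
  have hX : ∀ s : ℂ, (fun i => (X i).eval s) = toComplex u + s • toComplex v := by
    intro s; ext i; simp [X]; ring
  have hg : ∀ s : ℂ, (fun i => (g i).eval s) = complexValue G u v s := by
    intro s; ext i; simp [g, complexValue]; ring
  have hz : ∀ s : ℂ, (fun i => (z i).eval s) = toComplex u := by
    intro s; ext i; simp [z]
  have hXr : ∀ s : ℝ, (fun i => (X i).eval (s : ℂ)) = toComplex (u + s • v) := by
    intro s; rw [hX, toComplex_add, toComplex_smul]
  have hgr : ∀ s : ℝ, (fun i => (g i).eval (s : ℂ)) = toComplex (G (u + s • v)) := by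
    intro s; rw [hg, toComplex_quadraticMap_add_smul]
  have hq : X ⬝ᵥ X = (Polynomial.X - Polynomial.C Complex.I) *
      (Polynomial.C (⟪u, u⟫ : ℂ) * (Polynomial.X + Polynomial.C Complex.I)) := by
    apply polynomial_eq_of_eval_ofReal
    intro s
    rw [eval_dotProduct, hXr, toComplex_dotProduct]
    simp only [inner_add_left, inner_add_right, inner_smul_left, inner_smul_right, ho,
      real_inner_comm u v, ← huv, RCLike.conj_to_real, Polynomial.eval_mul, Polynomial.eval_sub,
      Polynomial.eval_add, Polynomial.eval_X, Polynomial.eval_C]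
    push_cast
    linear_combination (⟪u, u⟫ : ℂ) * Complex.I_mul_I
  have hb : 2 * (X ⬝ᵥ g) * ((X ⬝ᵥ X) * (g ⬝ᵥ g) - (X ⬝ᵥ g) ^ 2) =
      (X ⬝ᵥ X) * ((X ⬝ᵥ X) * (PT ⬝ᵥ g) - (X ⬝ᵥ g) * (PT ⬝ᵥ X)) := by
    apply polynomial_eq_of_eval_ofReal
    intro s
    simp only [Polynomial.eval_mul, Polynomial.eval_sub, Polynomial.eval_pow, eval_dotProduct,
      hXr, hgr, hPT, toComplex_dotProduct, Polynomial.eval_ofNat]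
    have := congrArg Complex.ofReal (hcoef s).2.1
    push_cast at this
    linear_combination this
  have hcc : ((g ⬝ᵥ g) + 2 * (X ⬝ᵥ PT)) * ((X ⬝ᵥ X) * (g ⬝ᵥ g) - (X ⬝ᵥ g) ^ 2) =
      (X ⬝ᵥ X) * ((X ⬝ᵥ X) * (PF ⬝ᵥ g) - (X ⬝ᵥ g) * (PF ⬝ᵥ X)) := by
    apply polynomial_eq_of_eval_ofReal
    intro s
    simp only [Polynomial.eval_mul, Polynomial.eval_sub, Polynomial.eval_pow, eval_dotProduct,
      hXr, hgr, hPT, hPF, toComplex_dotProduct, Polynomial.eval_ofNat, Polynomial.eval_add]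
    have := congrArg Complex.ofReal (hcoef s).2.2
    push_cast at this
    linear_combination this
  -- The determinant of the products of `X`, `g`, `PT` with `X`, `g`, `z`; it vanishes because `T`
  -- is a combination of `v` and `g`.
  have hd : (X ⬝ᵥ X) * ((g ⬝ᵥ g) * (PT ⬝ᵥ z) - (g ⬝ᵥ z) * (PT ⬝ᵥ g)) -
      (X ⬝ᵥ g) * ((X ⬝ᵥ g) * (PT ⬝ᵥ z) - (g ⬝ᵥ z) * (X ⬝ᵥ PT)) +
      (X ⬝ᵥ z) * ((X ⬝ᵥ g) * (PT ⬝ᵥ g) - (g ⬝ᵥ g) * (X ⬝ᵥ PT)) = 0 := by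
    apply polynomial_eq_of_eval_ofReal
    intro s
    obtain ⟨a, b, hab⟩ := (hcoef s).1
    simp only [Polynomial.eval_mul, Polynomial.eval_sub, Polynomial.eval_add, eval_dotProduct,
      hXr, hgr, hPT, hz, toComplex_dotProduct, Polynomial.eval_zero, hab]
    generalize G (u + s • v) = y
    generalize u + s • v = x
    simp only [inner_add_left, inner_add_right, inner_smul_left, inner_smul_right,
      RCLike.conj_to_real]
    push_cast
    ring
  have eq0 : (X ⬝ᵥ X).eval Complex.I = 0 := by rw [hq]; simp
  have ez : (X ⬝ᵥ z).eval Complex.I = (⟪u, u⟫ : ℂ) := by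
    rw [eval_dotProduct, hX, hz, add_dotProduct, smul_dotProduct, toComplex_dotProduct,
      toComplex_dotProduct, real_inner_comm u v, ho]
    simp
  -- At `s = i` the factor `X ⬝ᵥ X` vanishes and `hb` reduces to `-2 (X ⬝ᵥ g)³ = 0`.
  have ep : (X ⬝ᵥ g).eval Complex.I = 0 := by
    have := congrArg (Polynomial.eval Complex.I) hb
    simp only [Polynomial.eval_mul, Polynomial.eval_sub, Polynomial.eval_pow, eq0,
      Polynomial.eval_ofNat] at this
    have h3 : (X ⬝ᵥ g).eval Complex.I ^ 3 = 0 := by linear_combination (-1 / 2) * this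
    exact pow_eq_zero_iff (by norm_num) |>.mp h3
  obtain ⟨p, hp⟩ := Polynomial.dvd_iff_isRoot.mpr ep
  have ed : (g ⬝ᵥ g).eval Complex.I * (X ⬝ᵥ PT).eval Complex.I = 0 := by
    have := congrArg (Polynomial.eval Complex.I) hd
    simp only [Polynomial.eval_mul, Polynomial.eval_sub, Polynomial.eval_add, eq0, ep, ez,
      Polynomial.eval_zero] at this
    refine mul_left_cancel₀ hc ?_
    linear_combination -this
  -- Both `X ⬝ᵥ X` and `X ⬝ᵥ g` contain `s - i`, so `hcc` can be divided by it once. At `s = i`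
  -- there remains `(g·g + 2 X·PT) (g·g) = 0` up to the factor `2i (u, u)`, and `ed` removes the
  -- mixed term.
  have en : (g ⬝ᵥ g).eval Complex.I = 0 := by
    have h0 : (Polynomial.X - Polynomial.C Complex.I) ≠ 0 := Polynomial.X_sub_C_ne_zero _
    rw [hp, hq] at hcc
    have h1 := mul_left_cancel₀ h0 (show (Polynomial.X - Polynomial.C Complex.I) *
      (((g ⬝ᵥ g) + 2 * (X ⬝ᵥ PT)) *
        ((Polynomial.C (⟪u, u⟫ : ℂ) * (Polynomial.X + Polynomial.C Complex.I)) * (g ⬝ᵥ g) -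
          (Polynomial.X - Polynomial.C Complex.I) * p ^ 2)) =
      (Polynomial.X - Polynomial.C Complex.I) * ((Polynomial.X - Polynomial.C Complex.I) *
      ((Polynomial.C (⟪u, u⟫ : ℂ) * (Polynomial.X + Polynomial.C Complex.I)) *
      ((Polynomial.C (⟪u, u⟫ : ℂ) * (Polynomial.X + Polynomial.C Complex.I)) * (PF ⬝ᵥ g) -
        p * (PF ⬝ᵥ X)))) by linear_combination hcc)
    have := congrArg (Polynomial.eval Complex.I) h1
    simp only [Polynomial.eval_mul, Polynomial.eval_sub, Polynomial.eval_add, Polynomial.eval_X,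
      Polynomial.eval_C, Polynomial.eval_ofNat, Polynomial.eval_pow, sub_self, zero_mul,
      sub_zero] at this
    have h2 : (⟪u, u⟫ : ℂ) * (2 * Complex.I) ≠ 0 := mul_ne_zero hc (by simp)
    have h3 : (g ⬝ᵥ g).eval Complex.I ^ 2 = 0 := by
      refine mul_left_cancel₀ h2 ?_
      linear_combination this - 4 * Complex.I * (⟪u, u⟫ : ℂ) * ed
    exact pow_eq_zero_iff (by norm_num) |>.mp h3
  rw [eval_dotProduct, hX, hg] at ep
  rw [eval_dotProduct, hg] at en
  exact ⟨ep, en⟩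

end Complexification

/-! ### Divisibility by `(x, x)` of forms vanishing on the isotropic cone. -/

section Division

variable {n : ℕ}

theorem exists_orthogonal_decomposition {x : Euc n} (hx : x ≠ 0) (y : Euc n) :
    ∃ (α β : ℝ) (v : Euc n), y = α • x + β • v ∧ (β = 0 ∨ ⟪x, x⟫ = ⟪v, v⟫ ∧ ⟪x, v⟫ = 0) := by
  have hxn : ‖x‖ ≠ 0 := norm_ne_zero_iff.mpr hx
  by_cases hz : perp x y = 0
  · refine ⟨⟪x, y⟫ / ⟪x, x⟫, 0, 0, ?_, Or.inl rfl⟩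
    rw [perp, sub_eq_zero] at hz
    rw [← hz]; simp
  · have hzn : ‖perp x y‖ ≠ 0 := norm_ne_zero_iff.mpr hz
    refine ⟨⟪x, y⟫ / ⟪x, x⟫, ‖perp x y‖ / ‖x‖, (‖x‖ / ‖perp x y‖) • perp x y, ?_,
      Or.inr ⟨?_, ?_⟩⟩
    · have : ‖perp x y‖ / ‖x‖ * (‖x‖ / ‖perp x y‖) = 1 := by field_simp
      rw [smul_smul, this, one_smul, perp]; abel
    · rw [inner_smul_left, inner_smul_right, real_inner_self_eq_norm_sq,
        real_inner_self_eq_norm_sq, RCLike.conj_to_real]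
      field_simp
    · rw [inner_smul_right, inner_perp hx, mul_zero]

/-- Any two independent vectors span a plane with a basis of orthogonal vectors of equal length;
dependent ones are handled by homogeneity. -/
theorem exists_linearMap_of_orthogonal {f : Euc n → ℝ} (hf : ∀ (a : ℝ) x, f (a • x) = a * f x)
    (h : ∀ u v : Euc n, ⟪u, u⟫ = ⟪v, v⟫ → ⟪u, v⟫ = 0 →
      ∀ a b : ℝ, f (a • u + b • v) = a * f u + b * f v) :
    ∃ l : Euc n →ₗ[ℝ] ℝ, ∀ x, l x = f x := by
  refine ⟨⟨⟨f, fun x y => ?_⟩, hf⟩, fun x => rfl⟩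
  by_cases hx : x = 0
  · have := hf 0 x
    simp at this
    simp [hx, this]
  obtain ⟨α, β, v, rfl, rfl | ⟨h1, h2⟩⟩ := exists_orthogonal_decomposition hx y
  · have e : x + (α • x + (0 : ℝ) • v) = (1 + α) • x := by module
    rw [e, zero_smul, add_zero, hf, hf]; ring
  · have e : x + (α • x + β • v) = (1 + α) • x + β • v := by module
    rw [e, h x v h1 h2, h x v h1 h2]; ring

theorem exists_quadraticMap_of_orthogonal {f : Euc n → ℝ} (hf : ∀ (a : ℝ) x, f (a • x) = a ^ 2 * f x)
    (h : ∀ u v : Euc n, ⟪u, u⟫ = ⟪v, v⟫ → ⟪u, v⟫ = 0 →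
      ∃ A B C : ℝ, ∀ a b : ℝ, f (a • u + b • v) = a ^ 2 * A + a * b * B + b ^ 2 * C) :
    ∃ Q : QuadraticMap ℝ (Euc n) ℝ, ∀ x, Q x = f x := by
  have h' : ∀ u v : Euc n,
      ∃ A B C : ℝ, ∀ a b : ℝ, f (a • u + b • v) = a ^ 2 * A + a * b * B + b ^ 2 * C := by
    intro x y
    by_cases hx : x = 0
    · refine ⟨0, 0, f y, fun a b => ?_⟩
      rw [hx, smul_zero, zero_add, hf]; ring
    obtain ⟨α, β, v, rfl, rfl | ⟨h1, h2⟩⟩ := exists_orthogonal_decomposition hx y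
    · refine ⟨f x, 2 * α * f x, α ^ 2 * f x, fun a b => ?_⟩
      have e : a • x + b • (α • x + (0 : ℝ) • v) = (a + b * α) • x := by module
      rw [e, hf]; ring
    · obtain ⟨A, B, C, hABC⟩ := h x v h1 h2
      refine ⟨A, 2 * α * A + β * B, α ^ 2 * A + α * β * B + β ^ 2 * C, fun a b => ?_⟩
      have e : a • x + b • (α • x + β • v) = (a + b * α) • x + (b * β) • v := by module
      rw [e, hABC]; ring
  refine exists_quadraticMap_of_isForm_two fun u v => ?_
  obtain ⟨A, B, C, hABC⟩ := h' u v
  refine ⟨fun i => if i = 0 then A else if i = 1 then B else C, fun a b => ?_⟩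
  rw [hABC]
  simp [Finset.sum_range_succ]

theorem quadraticMap_smul_add_smul (G : QuadraticMap ℝ (Euc n) (Euc n)) (u v : Euc n) (a b : ℝ) :
    G (a • u + b • v) = a ^ 2 • G u + (a * b) • QuadraticMap.polar G u v + b ^ 2 • G v := by
  rw [QuadraticMap.map_add G, QuadraticMap.polar_smul_left, QuadraticMap.polar_smul_right,
    QuadraticMap.map_smul, QuadraticMap.map_smul]
  module

/-- If the cubic form `⟪x, G x⟫` vanishes on complex isotropic vectors, it is divisible by
`⟪x, x⟫`. -/
theorem exists_linear_factor {G : QuadraticMap ℝ (Euc n) (Euc n)}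
    (h : ∀ u v : Euc n, ⟪u, u⟫ = ⟪v, v⟫ → ⟪u, v⟫ = 0 →
      ⟪u, G u⟫ = ⟪u, G v⟫ + ⟪v, QuadraticMap.polar G u v⟫ ∧
      ⟪v, G v⟫ = ⟪v, G u⟫ + ⟪u, QuadraticMap.polar G u v⟫) :
    ∃ l : Euc n →ₗ[ℝ] ℝ, ∀ x, ⟪x, G x⟫ = ⟪x, x⟫ * l x := by
  obtain ⟨l, hl⟩ := exists_linearMap_of_orthogonal (f := fun x => ⟪x, G x⟫ / ⟪x, x⟫)
    (fun a x => by
      simp only [QuadraticMap.map_smul, inner_smul_left, inner_smul_right, RCLike.conj_to_real]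
      by_cases hx : ⟪x, x⟫ = 0
      · simp [inner_self_eq_zero.mp hx]
      by_cases ha : a = 0
      · simp [ha]
      field_simp)
    -- On `a u + b v` the cubic has equal coefficients at `a³` and `a b²` by `e1`, and at `b³` and
    -- `a² b` by `e2`; so it is `a² + b²` times a linear form.
    (fun u v h1 h2 a b => by
      obtain ⟨e1, e2⟩ := h u v h1 h2
      have hvu : ⟪v, u⟫ = 0 := by rw [real_inner_comm, h2]
      simp only [quadraticMap_smul_add_smul, inner_add_left, inner_add_right, inner_smul_left,
        inner_smul_right, RCLike.conj_to_real, h2, hvu, ← h1]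
      by_cases hu : ⟪u, u⟫ = 0
      · have hv := inner_self_eq_zero.mp (h1.symm.trans hu)
        simp [inner_self_eq_zero.mp hu, hv]
      by_cases hab : a ^ 2 + b ^ 2 = 0
      · have ha : a = 0 := by nlinarith [sq_nonneg a, sq_nonneg b]
        have hb : b = 0 := by nlinarith [sq_nonneg a, sq_nonneg b]
        simp [ha, hb]
      have hd : a * (a * ⟪u, u⟫ + b * 0) + b * (a * 0 + b * ⟪u, u⟫) =
          (a ^ 2 + b ^ 2) * ⟪u, u⟫ := by ring
      have hd' : a * (a * ⟪u, u⟫ + b * 0) + b * (a * 0 + b * ⟪u, u⟫) ≠ 0 := by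
        rw [hd]; exact mul_ne_zero hab hu
      rw [← mul_div_assoc, ← mul_div_assoc, ← add_div, div_eq_div_iff (by simpa using hd') hu]
      linear_combination (-a * b ^ 2 * ⟪u, u⟫) * e1 - a ^ 2 * b * ⟪u, u⟫ * e2)
  refine ⟨l, fun x => ?_⟩
  rw [hl]
  by_cases hx : ⟪x, x⟫ = 0
  · simp [inner_self_eq_zero.mp hx]
  · field_simp

/-- If the quartic form `⟪G x, G x⟫` vanishes on complex isotropic vectors, it is divisible by
`⟪x, x⟫`. -/
theorem exists_quadratic_factor {G : QuadraticMap ℝ (Euc n) (Euc n)}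
    (h : ∀ u v : Euc n, ⟪u, u⟫ = ⟪v, v⟫ → ⟪u, v⟫ = 0 →
      ⟪QuadraticMap.polar G u v, QuadraticMap.polar G u v⟫ = ⟪G u, G u⟫ + ⟪G v, G v⟫
        - 2 * ⟪G u, G v⟫ ∧
      ⟪G u, QuadraticMap.polar G u v⟫ = ⟪G v, QuadraticMap.polar G u v⟫) :
    ∃ Q : QuadraticMap ℝ (Euc n) ℝ, ∀ x, ⟪G x, G x⟫ = ⟪x, x⟫ * Q x := by
  obtain ⟨Q, hQ⟩ := exists_quadraticMap_of_orthogonal (f := fun x => ⟪G x, G x⟫ / ⟪x, x⟫)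
    (fun a x => by
      simp only [QuadraticMap.map_smul, inner_smul_left, inner_smul_right, RCLike.conj_to_real]
      by_cases hx : ⟪x, x⟫ = 0
      · simp [inner_self_eq_zero.mp hx]
      by_cases ha : a = 0
      · simp [ha]
      field_simp)
    (fun u v h1 h2 => by
      obtain ⟨e1, e2⟩ := h u v h1 h2
      have hvu : ⟪v, u⟫ = 0 := by rw [real_inner_comm, h2]
      -- The coefficients of the quotient of the binary quartic by `(a² + b²) (u, u)`.
      refine ⟨⟪G u, G u⟫ / ⟪u, u⟫, 2 * ⟪G u, QuadraticMap.polar G u v⟫ / ⟪u, u⟫,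
        ⟪G v, G v⟫ / ⟪u, u⟫, fun a b => ?_⟩
      have c1 := real_inner_comm (G u) (QuadraticMap.polar G u v)
      have c2 := real_inner_comm (G v) (QuadraticMap.polar G u v)
      have c3 := real_inner_comm (G u) (G v)
      simp only [quadraticMap_smul_add_smul, inner_add_left, inner_add_right, inner_smul_left,
        inner_smul_right, RCLike.conj_to_real, h2, hvu, ← h1]
      by_cases hu : ⟪u, u⟫ = 0
      · simp only [hu, mul_zero, add_zero, div_zero]
      by_cases hab : a ^ 2 + b ^ 2 = 0
      · have ha : a = 0 := by nlinarith [sq_nonneg a, sq_nonneg b]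
        have hb : b = 0 := by nlinarith [sq_nonneg a, sq_nonneg b]
        simp [ha, hb]
      have hd : a * (a * ⟪u, u⟫ + b * 0) + b * (a * 0 + b * ⟪u, u⟫) =
          (a ^ 2 + b ^ 2) * ⟪u, u⟫ := by ring
      have hd' : a * (a * ⟪u, u⟫ + b * 0) + b * (a * 0 + b * ⟪u, u⟫) ≠ 0 := by
        rw [hd]; exact mul_ne_zero hab hu
      rw [← mul_div_assoc, ← mul_div_assoc, ← mul_div_assoc, ← add_div, ← add_div,
        div_eq_div_iff (by simpa using hd') hu]
      rw [c1, c2, c3, ← e2]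
      linear_combination a ^ 2 * b ^ 2 * ⟪u, u⟫ * e1)
  refine ⟨Q, fun x => ?_⟩
  rw [hQ]
  by_cases hx : ⟪x, x⟫ = 0
  · simp [inner_self_eq_zero.mp hx]
  · field_simp

theorem complexValue_I (G : QuadraticMap ℝ (Euc n) (Euc n)) (u v : Euc n) :
    complexValue G u v Complex.I =
      toComplex (G u - G v) + Complex.I • toComplex (QuadraticMap.polar G u v) := by
  rw [complexValue, Complex.I_sq, toComplex_sub]
  module

theorem dotProduct_add_I_smul (u v y z : Euc n) :
    (toComplex u + Complex.I • toComplex v) ⬝ᵥ (toComplex y + Complex.I • toComplex z) = 0 ↔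
      ⟪u, y⟫ = ⟪v, z⟫ ∧ ⟪u, z⟫ + ⟪v, y⟫ = 0 := by
  have key : (toComplex u + Complex.I • toComplex v) ⬝ᵥ (toComplex y + Complex.I • toComplex z) =
      ((⟪u, y⟫ - ⟪v, z⟫ : ℝ) : ℂ) + (⟪u, z⟫ + ⟪v, y⟫ : ℝ) * Complex.I := by
    simp only [add_dotProduct, dotProduct_add, smul_dotProduct, dotProduct_smul,
      toComplex_dotProduct, smul_eq_mul]
    push_cast
    linear_combination (⟪v, z⟫ : ℂ) * Complex.I_mul_I
  have aux : ∀ a b : ℝ, (a : ℂ) + b * Complex.I = 0 ↔ a = 0 ∧ b = 0 := by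
    intro a b
    simp [Complex.ext_iff]
  rw [key, aux, sub_eq_zero]

theorem orthogonal_identities {G : QuadraticMap ℝ (Euc n) (Euc n)} {u v : Euc n}
    (h : (toComplex u + Complex.I • toComplex v) ⬝ᵥ complexValue G u v Complex.I = 0) :
    ⟪u, G u⟫ = ⟪u, G v⟫ + ⟪v, QuadraticMap.polar G u v⟫ ∧
      ⟪v, G v⟫ = ⟪v, G u⟫ + ⟪u, QuadraticMap.polar G u v⟫ := by
  rw [complexValue_I, dotProduct_add_I_smul, inner_sub_right, inner_sub_right] at h
  exact ⟨by linarith [h.1], by linarith [h.2]⟩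

theorem isotropic_identities {G : QuadraticMap ℝ (Euc n) (Euc n)} {u v : Euc n}
    (h : complexValue G u v Complex.I ⬝ᵥ complexValue G u v Complex.I = 0) :
    ⟪QuadraticMap.polar G u v, QuadraticMap.polar G u v⟫ = ⟪G u, G u⟫ + ⟪G v, G v⟫
        - 2 * ⟪G u, G v⟫ ∧
      ⟪G u, QuadraticMap.polar G u v⟫ = ⟪G v, QuadraticMap.polar G u v⟫ := by
  rw [complexValue_I, dotProduct_add_I_smul] at h
  simp only [inner_sub_left, inner_sub_right] at h
  have c1 := real_inner_comm (G u) (QuadraticMap.polar G u v)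
  have c2 := real_inner_comm (G v) (QuadraticMap.polar G u v)
  have c3 := real_inner_comm (G u) (G v)
  exact ⟨by linarith [h.1], by linarith [h.2]⟩

theorem IsAdmissible.isotropic_complexValue {Γ : QuadMap n} (hΓ : IsAdmissible Γ)
    {G : QuadraticMap ℝ (Euc n) (Euc n)} (h : IsComplexification Γ G) {u v : Euc n}
    (huv : ⟪u, u⟫ = ⟪v, v⟫) (ho : ⟪u, v⟫ = 0) :
    (toComplex u + Complex.I • toComplex v) ⬝ᵥ complexValue G u v Complex.I = 0 ∧
    complexValue G u v Complex.I ⬝ᵥ complexValue G u v Complex.I = 0 := by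
  have h0 := (dotProduct_self_add_I_smul u v).mpr ⟨huv, ho⟩
  rw [← h.apply_add_smul]
  exact ⟨hΓ.orthogonal _ h0, hΓ.isotropic _ h0⟩

end Division

/-! ### The explicit germ carrying lines to circles. -/

section Construction

variable {n : ℕ}

/-- The quadratic map `x ↦ l(x) x`. -/
noncomputable def smulSelf (l : Euc n →ₗ[ℝ] ℝ) : QuadraticMap ℝ (Euc n) (Euc n) :=
  LinearMap.BilinMap.toQuadraticMap (LinearMap.comp (LinearMap.lsmul ℝ (Euc n)) l)

@[simp]
theorem smulSelf_apply (l : Euc n →ₗ[ℝ] ℝ) (x : Euc n) : smulSelf l x = l x • x := rfl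

theorem quadraticMap_isBigO {F : Type} [NormedAddCommGroup F] [NormedSpace ℝ F]
    (Q : QuadraticMap ℝ (Euc n) F) : (Q : Euc n → F) =O[𝓝 0] fun x => ‖x‖ ^ 2 := by
  let A := LinearMap.toContinuousLinearMap
      ((LinearMap.toContinuousLinearMap (E := Euc n) (F' := F) (𝕜 := ℝ)).toLinearMap ∘ₗ Q.polarBilin)
  have : ∀ x, Q x = (1 / 2 : ℝ) • A x x := by
    intro x
    simp [A, QuadraticMap.polar_self, ← Nat.cast_smul_eq_nsmul ℝ, smul_smul]
  refine IsBigO.of_bound ((1 / 2) * ‖A‖) (Eventually.of_forall fun x => ?_)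
  rw [this, norm_smul, Real.norm_of_nonneg (by norm_num), norm_pow, norm_norm, mul_assoc, pow_two,
    ← mul_assoc ‖A‖]
  gcongr
  exact A.le_opNorm₂ x x

theorem hasFDerivAt_id_of_isLittleO {f : Euc n → Euc n} {G : QuadraticMap ℝ (Euc n) (Euc n)}
    (h0 : f 0 = 0) (ho : (fun x => f x - x - G x) =o[𝓝 (0 : Euc n)] fun x => ‖x‖ ^ 2) :
    HasFDerivAt f (ContinuousLinearMap.id ℝ (Euc n)) 0 := by
  rw [hasFDerivAt_iff_isLittleO_nhds_zero]
  have h1 : (fun x : Euc n => ‖x‖ ^ 2) =o[𝓝 0] fun x => x := by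
    simpa using (isLittleO_norm_pow_id (E' := Euc n) (one_lt_two))
  have h2 := (ho.isBigO.add (quadraticMap_isBigO G)).trans_isLittleO h1
  refine h2.congr_left fun x => ?_
  simp [h0]

variable {G : QuadraticMap ℝ (Euc n) (Euc n)} {μ : QuadraticMap ℝ (Euc n) ℝ}

/-- The map taking each line through the origin to the circle osculating the curve
`t ↦ t v + t² G(v)`. -/
noncomputable def lineToCircle (G : QuadraticMap ℝ (Euc n) (Euc n)) (μ : QuadraticMap ℝ (Euc n) ℝ)
    (x : Euc n) : Euc n :=
  (1 + μ x)⁻¹ • (x + G x)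

theorem factor_nonneg (hμ : ∀ x, ⟪G x, G x⟫ = ⟪x, x⟫ * μ x) (x : Euc n) : 0 ≤ μ x := by
  by_cases hx : x = 0
  · simp [hx]
  · have h1 : 0 < ⟪x, x⟫ := real_inner_self_pos.mpr hx
    have h2 : 0 ≤ ⟪x, x⟫ * μ x := hμ x ▸ real_inner_self_nonneg
    exact nonneg_of_mul_nonneg_right h2 h1

/-- On the line of `v` the denominator `1 + μ (t v)` is `1 + t² (G v, G v) / (v, v)`, the one in
`circPoint`. Divisibility by `(x, x)` makes it smooth in all of `x`. -/
theorem lineToCircle_smul (hμ : ∀ x, ⟪G x, G x⟫ = ⟪x, x⟫ * μ x) {v : Euc n} (hv : v ≠ 0) (t : ℝ) :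
    lineToCircle G μ (t • v) = circPoint v (G v) t := by
  have hvv : ⟪v, v⟫ ≠ 0 := inner_self_ne_zero.mpr hv
  rw [lineToCircle, circPoint, hμ, mul_div_cancel_left₀ _ hvv, QuadraticMap.map_smul,
    QuadraticMap.map_smul, smul_eq_mul, ← pow_two]

theorem contDiff_lineToCircle (hμ : ∀ x, ⟪G x, G x⟫ = ⟪x, x⟫ * μ x) :
    ContDiff ℝ ∞ (lineToCircle G μ) := by
  have h1 : ContDiff ℝ ∞ μ := contDiff_quadraticMap μ
  have h2 : ContDiff ℝ ∞ G := contDiff_quadraticMap G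
  refine ContDiff.smul (ContDiff.inv (contDiff_const.add h1) fun x => ?_) (contDiff_id.add h2)
  have := factor_nonneg hμ x
  positivity

theorem lineToCircle_isLittleO (hμ : ∀ x, ⟪G x, G x⟫ = ⟪x, x⟫ * μ x) :
    (fun x => lineToCircle G μ x - x - G x) =o[𝓝 (0 : Euc n)] fun x => ‖x‖ ^ 2 := by
  have h2 : ContDiff ℝ ∞ G := contDiff_quadraticMap G
  have hb : (fun x => -(μ x / (1 + μ x))) =O[𝓝 (0 : Euc n)] fun x => ‖x‖ ^ 2 := by
    refine IsBigO.trans (IsBigO.of_bound 1 (Eventually.of_forall fun x => ?_))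
      (quadraticMap_isBigO μ)
    have := factor_nonneg hμ x
    rw [norm_neg, one_mul, Real.norm_of_nonneg (by positivity), Real.norm_of_nonneg this]
    exact div_le_self this (by linarith)
  have ho : (fun x => x + G x) =o[𝓝 (0 : Euc n)] fun _ => (1 : ℝ) := by
    rw [isLittleO_one_iff]
    have : Tendsto (fun x => x + G x) (𝓝 (0 : Euc n)) (𝓝 (0 + G 0)) :=
      (continuous_id.add h2.continuous).tendsto (0 : Euc n)
    simpa using this
  have := hb.smul_isLittleO ho
  simp only [smul_eq_mul, mul_one] at this
  refine this.congr_left fun x => ?_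
  have hx := factor_nonneg hμ x
  have e : -(μ x / (1 + μ x)) = (1 + μ x)⁻¹ - 1 := by
    have : 1 + μ x ≠ 0 := by positivity
    field_simp
    ring
  rw [e, lineToCircle]
  module

theorem exists_bundle (hG : ∀ x, ⟪x, G x⟫ = 0) (hμ : ∀ x, ⟪G x, G x⟫ = ⟪x, x⟫ * μ x) :
    ∃ B : Set (Set (Euc n)), IsCompleteBundle B ∧
      ∃ Φ : OpenPartialHomeomorph (Euc n) (Euc n), StraightensWith Φ G B := by
  have h0 : lineToCircle G μ 0 = 0 := by simp [lineToCircle]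
  obtain ⟨Φ, hΦ, hcoe⟩ := exists_isDiffeoGerm_of_hasFDerivAt_id (contDiff_lineToCircle hμ)
    (hasFDerivAt_id_of_isLittleO h0 (lineToCircle_isLittleO hμ))
  have hsame : ∀ v v' d : Euc n, v ≠ 0 → v' ≠ 0 → HasDirection (circ v (G v)) d →
      HasDirection (circ v' (G v')) d → circ v (G v) = circ v' (G v') := by
    intro v v' d hv hv' hd hd'
    obtain ⟨a, ha, rfl⟩ := exists_eq_smul_of_hasDirection_circ hv (hG v) hd
    obtain ⟨b, hb, hab⟩ := exists_eq_smul_of_hasDirection_circ hv' (hG v') hd'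
    rw [← circ_smul ha v, ← circ_smul hb v', pow_two, pow_two, ← QuadraticMap.map_smul,
      ← QuadraticMap.map_smul, hab]
  refine ⟨{S | ∃ v : Euc n, v ≠ 0 ∧ S = circ v (G v)}, ⟨⟨?_, ?_, ?_⟩, ?_⟩, Φ, hΦ, ?_, ?_, ?_⟩
  · rintro _ ⟨v, hv, rfl⟩
    exact isCircle_circ hv (hG v)
  · rintro _ ⟨v, hv, rfl⟩
    exact zero_mem_circ _ _
  · rintro _ ⟨v, hv, rfl⟩ _ ⟨v', hv', rfl⟩ hne d ⟨hd, hd'⟩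
    exact hne (hsame v v' d hv hv' hd hd')
  · intro v hv
    refine ⟨circ v (G v), ⟨⟨v, hv, rfl⟩, hasDirection_circ hv (hG v)⟩, ?_⟩
    rintro _ ⟨⟨v', hv', rfl⟩, hd'⟩
    exact hsame v' v v hv' hv hd' (hasDirection_circ hv (hG v))
  · rw [hcoe, h0]
  · rintro _ ⟨v, hv, rfl⟩
    have hvv : ⟪v, v⟫ ≠ 0 := inner_self_ne_zero.mpr hv
    refine ⟨(Submodule.span ℝ {v}).toAffineSubspace, ?_, ?_⟩
    · rw [IsLine, Submodule.toAffineSubspace_direction]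
      exact finrank_span_singleton hv
    -- The preimage of a point `x` of the circle is `t v` with `t` given by `eq_circPoint`; near `0`
    -- its denominator is nonzero and `t v` lies in the source.
    have hden : ContinuousAt (fun x : Euc n => ⟪v, v⟫ - ⟪x, G v⟫) 0 := by fun_prop
    have hden0 : ⟪v, v⟫ - ⟪(0 : Euc n), G v⟫ ≠ 0 := by simpa using hv
    have hcont : ContinuousAt (fun x : Euc n => (⟪x, v⟫ / (⟪v, v⟫ - ⟪x, G v⟫)) • v) 0 :=
      (ContinuousAt.div (by fun_prop) hden hden0).smul continuousAt_const
    have hsrc : ∀ᶠ x in 𝓝 (0 : Euc n), (⟪x, v⟫ / (⟪v, v⟫ - ⟪x, G v⟫)) • v ∈ Φ.source := by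
      refine hcont.eventually_mem (Φ.open_source.mem_nhds ?_)
      simpa using hΦ.zero_mem_source
    have htgt : ∀ᶠ x in 𝓝 (0 : Euc n), x ∈ Φ.target := by
      have := Φ.map_source hΦ.zero_mem_source
      rw [hcoe, h0] at this
      exact Φ.open_target.mem_nhds this
    filter_upwards [hsrc, htgt, hden.eventually_ne hden0] with x hx1 hx2 hx3
    rw [Submodule.mem_toAffineSubspace, Submodule.mem_span_singleton]
    constructor
    · intro hx
      refine ⟨⟪x, v⟫ / (⟪v, v⟫ - ⟪x, G v⟫), ?_⟩
      have e := eq_circPoint hv (hG v) hx hx3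
      rw [← lineToCircle_smul hμ hv, ← hcoe] at e
      conv_rhs => rw [e]
      exact (Φ.left_inv hx1).symm
    · rintro ⟨t, ht⟩
      have e := Φ.right_inv hx2
      rw [← ht, hcoe, lineToCircle_smul hμ hv] at e
      rw [← e]
      exact circPoint_mem hv (hG v) t
  · rw [hcoe]
    exact lineToCircle_isLittleO hμ

end Construction

/-! ### Freedom in the choice of the rectifying germ, and its normalization. -/

section Reparametrization

variable {n : ℕ} {Φ : OpenPartialHomeomorph (Euc n) (Euc n)}
  {G : QuadraticMap ℝ (Euc n) (Euc n)} {B : Set (Set (Euc n))}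

theorem IsDiffeoGerm.trans {Ψ : OpenPartialHomeomorph (Euc n) (Euc n)} (hΨ : IsDiffeoGerm Ψ)
    (h1 : ContDiffOn ℝ ∞ Φ Φ.source) (h2 : ContDiffOn ℝ ∞ Φ.symm Φ.target)
    (h0 : Ψ 0 ∈ Φ.source) : IsDiffeoGerm (Ψ.trans Φ) where
  zero_mem_source := by
    rw [OpenPartialHomeomorph.trans_source]
    exact ⟨hΨ.zero_mem_source, h0⟩
  contDiffOn := by
    rw [OpenPartialHomeomorph.trans_source, OpenPartialHomeomorph.coe_trans]
    exact h1.comp (hΨ.contDiffOn.mono Set.inter_subset_left) fun x hx => hx.2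
  contDiffOn_symm := by
    rw [OpenPartialHomeomorph.trans_target, OpenPartialHomeomorph.coe_trans_symm]
    exact hΨ.contDiffOn_symm.comp (h2.mono Set.inter_subset_left) fun x hx => hx.2

theorem hasFDerivAt_id_add_smulSelf (l : Euc n →ₗ[ℝ] ℝ) :
    HasFDerivAt (fun x : Euc n => x + smulSelf l x) (ContinuousLinearMap.id ℝ (Euc n)) 0 :=
  hasFDerivAt_id_of_isLittleO (G := smulSelf l) (by simp) (by simp)

theorem linearMap_tendsto_zero (l : Euc n →ₗ[ℝ] ℝ) : Tendsto l (𝓝 0) (𝓝 0) := by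
  have := l.continuous_of_finiteDimensional.tendsto 0
  rwa [map_zero] at this

/-- `x ↦ (1 + l x) x` moves points along their lines through `0`, so precomposing with it keeps the
straightening and adds `l(x) x` to the quadratic part. -/
theorem StraightensWith.add_smulSelf (h : StraightensWith Φ G B) (hB : IsSimpleBundle B)
    (l : Euc n →ₗ[ℝ] ℝ) :
    ∃ Φ' : OpenPartialHomeomorph (Euc n) (Euc n), StraightensWith Φ' (G + smulSelf l) B := by
  have hcd : ContDiff ℝ ∞ fun x : Euc n => x + smulSelf l x :=
    contDiff_id.add (contDiff_quadraticMap _)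
  obtain ⟨σ, hσ, hcoe⟩ := exists_isDiffeoGerm_of_hasFDerivAt_id hcd (hasFDerivAt_id_add_smulSelf l)
  have hσx : ∀ x, σ x = (1 + l x) • x := fun x => by
    simp only [hcoe, smulSelf_apply]; module
  have hσ0 : σ 0 = 0 := by rw [hσx, smul_zero]
  have hl := linearMap_tendsto_zero l
  have hΦ0 : Φ.symm 0 = 0 := by
    conv_lhs => rw [← h.map_zero]
    exact Φ.left_inv h.isDiffeoGerm.zero_mem_source
  have hsym0 : σ.symm 0 = 0 := by
    conv_lhs => rw [← hσ0]
    exact σ.left_inv hσ.zero_mem_source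
  have h0t : (0 : Euc n) ∈ σ.target := by
    have := σ.map_source hσ.zero_mem_source
    rwa [hσ0] at this
  have h0t' : (0 : Euc n) ∈ Φ.target := by
    have := Φ.map_source h.isDiffeoGerm.zero_mem_source
    rwa [h.map_zero] at this
  have htend : Tendsto Φ.symm (𝓝 0) (𝓝 0) := by
    have := (Φ.symm.continuousAt (x := 0) h0t').tendsto
    rwa [hΦ0] at this
  have htend' : Tendsto σ.symm (𝓝 0) (𝓝 0) := by
    have := (σ.symm.continuousAt (x := 0) h0t).tendsto
    rwa [hsym0] at this
  refine ⟨σ.trans Φ, hσ.trans h.isDiffeoGerm.contDiffOn h.isDiffeoGerm.contDiffOn_symm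
    (by rw [hσ0]; exact h.isDiffeoGerm.zero_mem_source), ?_, ?_, ?_⟩
  · rw [OpenPartialHomeomorph.coe_trans, Function.comp_apply, hσ0, h.map_zero]
  · intro S hS
    obtain ⟨L, hL, hiff⟩ := h.straightens S hS
    refine ⟨L, hL, ?_⟩
    have h0 : (0 : Euc n) ∈ L := by
      have := hiff.self_of_nhds.mp (hB.zero_mem S hS)
      rwa [hΦ0] at this
    have hdir : ∀ y, y ∈ L ↔ y ∈ L.direction := fun y => by
      rw [← AffineSubspace.vsub_right_mem_direction_iff_mem h0]; simp
    have hne : ∀ᶠ y in 𝓝 (0 : Euc n), 1 + l y ≠ 0 := by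
      have h3 : Tendsto (fun y => 1 + l y) (𝓝 0) (𝓝 (1 + 0)) := hl.const_add 1
      exact h3.eventually_ne (by norm_num)
    filter_upwards [hiff, htend.eventually (σ.open_target.mem_nhds h0t),
      htend.eventually (htend'.eventually hne)] with x hx1 hx2 hx3
    rw [hx1, OpenPartialHomeomorph.coe_trans_symm, Function.comp_apply]
    have e := σ.right_inv hx2
    rw [hσx] at e
    conv_lhs => rw [← e]
    rw [hdir, hdir, Submodule.smul_mem_iff _ hx3]
  · have htσ : Tendsto σ (𝓝 0) (𝓝 0) := by
      have := (σ.continuousAt hσ.zero_mem_source).tendsto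
      rwa [hσ0] at this
    have hO : (fun x => σ x) =O[𝓝 (0 : Euc n)] fun x => ‖x‖ := by
      have h3 : Tendsto (fun y => 1 + l y) (𝓝 0) (𝓝 (1 + 0)) := hl.const_add 1
      have := (h3.isBigO_one ℝ).smul (isBigO_refl (fun x : Euc n => x) (𝓝 0))
      simp only [one_smul, ← hσx] at this
      exact this.norm_right
    have hO2 : (fun x => ‖σ x‖ ^ 2) =O[𝓝 (0 : Euc n)] fun x => ‖x‖ ^ 2 := hO.norm_left.pow 2
    have h1 := (h.isLittleO.comp_tendsto htσ).trans_isBigO hO2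
    have h2 : (fun x => ((1 + l x) ^ 2 - 1) • G x) =o[𝓝 (0 : Euc n)] fun x => ‖x‖ ^ 2 := by
      have h3 : (fun x => (1 + l x) ^ 2 - 1) =o[𝓝 (0 : Euc n)] fun _ => (1 : ℝ) := by
        rw [isLittleO_one_iff]
        have : Tendsto (fun x => (1 + l x) ^ 2 - 1) (𝓝 0) (𝓝 ((1 + 0) ^ 2 - 1)) :=
          ((hl.const_add 1).pow 2).sub_const 1
        simpa using this
      simpa using h3.smul_isBigO (quadraticMap_isBigO G)
    refine (h1.add h2).congr_left fun x => ?_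
    rw [OpenPartialHomeomorph.coe_trans]
    simp only [Function.comp_apply, add_apply, smulSelf_apply]
    rw [show G (σ x) = ((1 + l x) * (1 + l x)) • G x by rw [hσx, QuadraticMap.map_smul]]
    generalize Φ (σ x) = y
    rw [hσx]
    module

/-- `G` and `G'` agree orthogonally to `v`, and their components along `v` are `l v • v` and `l' v •
v` with `l`, `l'` linear by divisibility. -/
theorem StraightensWith.exists_eq_add_smulSelf {Φ' : OpenPartialHomeomorph (Euc n) (Euc n)}
    {G' : QuadraticMap ℝ (Euc n) (Euc n)} (h : StraightensWith Φ G B)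
    (h' : StraightensWith Φ' G' B) (hB : IsCompleteBundle B) :
    ∃ l : Euc n →ₗ[ℝ] ℝ, G' = G + smulSelf l := by
  obtain ⟨l, hl⟩ := exists_linear_factor (G := G) fun u v huv ho =>
    orthogonal_identities (h.isotropic hB huv ho).1
  obtain ⟨l', hl'⟩ := exists_linear_factor (G := G') fun u v huv ho =>
    orthogonal_identities (h'.isotropic hB huv ho).1
  refine ⟨l' - l, ?_⟩
  ext1 v
  by_cases hv : v = 0
  · simp [hv]
  have hvv : ⟪v, v⟫ ≠ 0 := inner_self_ne_zero.mpr hv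
  have := h.perp_eq h' hB hv
  rw [perp, perp, hl, hl', mul_div_cancel_left₀ _ hvv, mul_div_cancel_left₀ _ hvv] at this
  rw [add_apply, smulSelf_apply, LinearMap.sub_apply, sub_smul]
  rw [sub_eq_sub_iff_add_eq_add] at this
  rw [← add_sub_assoc, eq_sub_iff_add_eq, this]

/-- Composing `Ψ.symm` with the affine map `x ↦ Ψ 0 + dΨ(0) x` normalizes the germ to fix `0` with
identity differential; affine maps preserve lines. -/
theorem IsRectifiable.exists_straightensWith (hB : IsRectifiable B) :
    ∃ (Φ : OpenPartialHomeomorph (Euc n) (Euc n)) (G : QuadraticMap ℝ (Euc n) (Euc n)),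
      StraightensWith Φ G B := by
  obtain ⟨Ψ, hΨ, hS⟩ := hB
  have hs := Ψ.open_source.mem_nhds hΨ.zero_mem_source
  have ht := Ψ.open_target.mem_nhds (Ψ.map_source hΨ.zero_mem_source)
  have hd : HasFDerivAt Ψ (fderiv ℝ Ψ 0) 0 :=
    ((hΨ.contDiffOn.contDiffAt hs).differentiableAt (by simp)).hasFDerivAt
  have hd' : HasFDerivAt Ψ.symm (fderiv ℝ Ψ.symm (Ψ 0)) (Ψ 0) :=
    ((hΨ.contDiffOn_symm.contDiffAt ht).differentiableAt (by simp)).hasFDerivAt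
  have hleft : (fderiv ℝ Ψ.symm (Ψ 0)).comp (fderiv ℝ Ψ 0) = ContinuousLinearMap.id ℝ _ := by
    refine (hd'.comp 0 hd).unique ((hasFDerivAt_id 0).congr_of_eventuallyEq ?_)
    filter_upwards [hs] with x hx using Ψ.left_inv hx
  have hd0 : HasFDerivAt Ψ (fderiv ℝ Ψ 0) (Ψ.symm (Ψ 0)) := by
    rwa [Ψ.left_inv hΨ.zero_mem_source]
  have hright : (fderiv ℝ Ψ 0).comp (fderiv ℝ Ψ.symm (Ψ 0)) = ContinuousLinearMap.id ℝ _ := by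
    refine (hd0.comp (Ψ 0) hd').unique ((hasFDerivAt_id (Ψ 0)).congr_of_eventuallyEq ?_)
    filter_upwards [ht] with x hx using Ψ.right_inv hx
  let A : Euc n ≃L[ℝ] Euc n := ContinuousLinearEquiv.equivOfInverse (fderiv ℝ Ψ 0)
    (fderiv ℝ Ψ.symm (Ψ 0)) (fun x => DFunLike.congr_fun hleft x)
    (fun x => DFunLike.congr_fun hright x)
  let e : Euc n ≃ₜ Euc n := A.toHomeomorph.trans (Homeomorph.addLeft (Ψ 0))
  have he : ∀ x, e x = Ψ 0 + A x := fun x => rfl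
  have hes : ∀ x, e.symm x = A.symm (-Ψ 0 + x) := fun x => rfl
  have hge : IsDiffeoGerm e.toOpenPartialHomeomorph := by
    refine ⟨by simp, ?_, ?_⟩
    · have : ContDiff ℝ ∞ fun x => Ψ 0 + A x := contDiff_const.add A.contDiff
      exact this.contDiffOn
    · have : ContDiff ℝ ∞ fun x => A.symm (-Ψ 0 + x) :=
        A.symm.contDiff.comp (contDiff_const.add contDiff_id)
      exact this.contDiffOn
  set Φ := e.toOpenPartialHomeomorph.trans Ψ.symm with hΦ
  have hΦx : ∀ x, Φ x = Ψ.symm (Ψ 0 + A x) := fun x => rfl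
  have hΦg : IsDiffeoGerm Φ := hge.trans (Φ := Ψ.symm) hΨ.contDiffOn_symm hΨ.contDiffOn (by
    simpa [he] using Ψ.map_source hΨ.zero_mem_source)
  have hΦ0 : Φ 0 = 0 := by
    rw [hΦx, map_zero, add_zero, Ψ.left_inv hΨ.zero_mem_source]
  have hΦd : HasFDerivAt Φ (ContinuousLinearMap.id ℝ (Euc n)) 0 := by
    have h1 : HasFDerivAt (fun x => Ψ 0 + A x) (fderiv ℝ Ψ 0) 0 :=
      (A.hasFDerivAt (x := 0)).const_add (Ψ 0)
    have h2 : HasFDerivAt Ψ.symm (fderiv ℝ Ψ.symm (Ψ 0)) (Ψ 0 + A 0) := by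
      rwa [map_zero, add_zero]
    have h3 := h2.comp 0 h1
    rw [hleft] at h3
    exact h3
  obtain ⟨p, hp, hr⟩ := exists_taylor_forms 2 (hΦg.contDiffOn.contDiffAt
    (Φ.open_source.mem_nhds hΦg.zero_mem_source))
  obtain ⟨G, hG⟩ := exists_quadraticMap_of_isForm_two (hp 2)
  have hlow : ∀ x, p 0 x = 0 ∧ p 1 x = x := by
    intro x
    have h2 := isLittleO_smul_line hr x
    have h1 : (fun t : ℝ => Φ (t • x) - t • x) =o[𝓝[≠] 0] fun t : ℝ => t := by
      have := hasFDerivAt_iff_isLittleO_nhds_zero.mp hΦd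
      simp only [zero_add, hΦ0, sub_zero, ContinuousLinearMap.id_apply] at this
      have := isLittleO_smul_line (k := 1) (f := fun x => Φ x - x) (by
        simpa using this.norm_right) x
      simpa using this
    -- The first-order comparison is multiplied by `t` to fit `coeffs_eq_zero_of_isLittleO`, which
    -- works at order `t²`; hence `a = 0` there.
    have h3 := (isBigO_refl (fun t : ℝ => t) (𝓝[≠] 0)).smul_isLittleO
      (h1.sub ((h2.trans_isBigO (isBigO_pow_of_le (by norm_num : 1 ≤ 2))).congr_right fun t => pow_one t))
    simp only [Finset.sum_range_succ, Finset.sum_range_zero, (hp _).map_smul] at h3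
    have h4 := smul_pow_isLittleO (by norm_num : 2 < 3) (p 2 x)
    obtain ⟨-, e0, e1⟩ := coeffs_eq_zero_of_isLittleO (a := 0) (b := p 0 x) (c := p 1 x - x)
      ((IsLittleO.sub (h3.congr_right fun t => by rw [smul_eq_mul, pow_two]) h4).congr_left
        fun t => by module)
    exact ⟨e0, sub_eq_zero.mp e1⟩
  refine ⟨Φ, G, hΦg, hΦ0, ?_, ?_⟩
  · intro S hSB
    obtain ⟨L, hL, hiff⟩ := hS S hSB
    let E : Euc n ≃ᵃ[ℝ] Euc n :=
      A.toLinearEquiv.toAffineEquiv.trans (AffineEquiv.constVAdd ℝ (Euc n) (Ψ 0))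
    have hE : ∀ x, E x = Ψ 0 + A x := fun x => rfl
    refine ⟨L.map (E.symm : Euc n →ᵃ[ℝ] Euc n), ?_, ?_⟩
    · rw [IsLine, AffineSubspace.map_direction]
      rw [IsLine] at hL
      rw [← hL]
      exact LinearEquiv.finrank_map_eq E.symm.linear L.direction
    · filter_upwards [hiff] with x hx
      have e1 : E (Φ.symm x) = Ψ x := by
        rw [hE]
        change Ψ 0 + A (A.symm (-Ψ 0 + Ψ x)) = Ψ x
        rw [A.apply_symm_apply]; abel
      rw [hx, ← e1]
      constructor
      · intro h
        exact ⟨_, h, E.symm_apply_apply _⟩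
      · rintro ⟨y, hy, hyx⟩
        rw [← hyx]
        change E (E.symm y) ∈ L
        rwa [E.apply_symm_apply]
  · refine hr.congr_left fun x => ?_
    rw [hG]
    simp only [Finset.sum_range_succ, Finset.sum_range_zero, (hlow x).1, (hlow x).2]
    abel

end Reparametrization

/-! ### Return to complex quadratic maps and assembly of the bijection. -/

section Correspondence

variable {n : ℕ}

/-- The real part of a complex vector. -/
noncomputable def rePart (n : ℕ) : (Fin n → ℂ) →ₗ[ℝ] Euc n where
  toFun z := WithLp.toLp 2 fun i => (z i).re
  map_add' x y := by ext i; simp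
  map_smul' a x := by ext i; simp

/-- The imaginary part of a complex vector. -/
noncomputable def imPart (n : ℕ) : (Fin n → ℂ) →ₗ[ℝ] Euc n where
  toFun z := WithLp.toLp 2 fun i => (z i).im
  map_add' x y := by ext i; simp
  map_smul' a x := by ext i; simp

theorem rePart_toComplex (x : Euc n) : rePart n (toComplex x) = x := by
  ext i; simp [rePart, toComplex]

theorem imPart_toComplex (x : Euc n) : imPart n (toComplex x) = 0 := by
  ext i; simp [imPart, toComplex]

theorem toComplex_rePart {z : Fin n → ℂ} (hz : imPart n z = 0) : toComplex (rePart n z) = z := by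
  ext i
  have : (z i).im = 0 := by simpa [imPart] using congrArg (fun y : Euc n => y i) hz
  apply Complex.ext <;> simp [rePart, toComplex, this]

theorem linearMap_isBigO {V W : Type*} [NormedAddCommGroup V] [NormedSpace ℝ V]
    [FiniteDimensional ℝ V] [NormedAddCommGroup W] [NormedSpace ℝ W] (f : V →ₗ[ℝ] W)
    {α : Type*} (l : Filter α) (g : α → V) : (fun a => f (g a)) =O[l] g :=
  f.toContinuousLinearMap.isBigO_comp g l

theorem isQuadraticPartOf_iff {Γ : QuadMap n} {B : Set (Set (Euc n))} :
    IsQuadraticPartOf Γ B ↔ ∃ G : QuadraticMap ℝ (Euc n) (Euc n), IsComplexification Γ G ∧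
      ∃ Φ : OpenPartialHomeomorph (Euc n) (Euc n), StraightensWith Φ G B := by
  constructor
  · rintro ⟨Φ, hΦ, h0, hS, ho⟩
    -- The imaginary part of the expansion is `-Im Γ`, which is homogeneous of degree 2 and
    -- `o(|x|²)`; so `Γ` is automatically real.
    have him : ∀ x, imPart n (Γ (toComplex x)) = 0 := by
      intro x
      have h1 := isLittleO_smul_line ((linearMap_isBigO (imPart n) _ _).trans_isLittleO ho) x
      simp only [map_sub, imPart_toComplex, sub_zero, zero_sub] at h1
      refine (coeffs_eq_zero_of_isLittleO (a := 0) (b := 0)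
        (h1.neg_left.congr_left fun t => ?_)).2.2
      rw [neg_neg, toComplex_smul, QuadraticMap.map_smul, smul_zero, zero_add, zero_add, pow_two,
        ← Complex.ofReal_mul, Complex.coe_smul, map_smul]
    obtain ⟨G, hG⟩ := exists_isComplexification_of_real
      fun x => ⟨rePart n (Γ (toComplex x)), (toComplex_rePart (him x)).symm⟩
    refine ⟨G, hG, Φ, hΦ, h0, hS, ?_⟩
    refine ((linearMap_isBigO (rePart n) _ _).trans_isLittleO ho).congr_left fun x => ?_
    simp only [map_sub, rePart_toComplex, hG x]
  · rintro ⟨G, hG, Φ, h⟩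
    refine ⟨Φ, h.isDiffeoGerm, h.map_zero, h.straightens, ?_⟩
    refine ((linearMap_isBigO (toComplexLinearMap n) _ _).trans_isLittleO h.isLittleO).congr_left
      fun x => ?_
    change toComplex _ = _
    rw [toComplex_sub, toComplex_sub, hG x]

theorem IsComplexification.ext {Γ Γ' : QuadMap n} {G : QuadraticMap ℝ (Euc n) (Euc n)}
    (h : IsComplexification Γ G) (h' : IsComplexification Γ' G) (x : Fin n → ℂ) : Γ' x = Γ x := by
  obtain ⟨u, v, rfl⟩ := exists_eq_toComplex_add x
  rw [h.apply_add_smul, h'.apply_add_smul]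

theorem IsComplexification.unique {Γ : QuadMap n} {G G' : QuadraticMap ℝ (Euc n) (Euc n)}
    (h : IsComplexification Γ G) (h' : IsComplexification Γ G') : G = G' := by
  ext1 x
  exact toComplex_injective ((h x).symm.trans (h' x))

theorem StraightensWith.isAdmissible {Φ : OpenPartialHomeomorph (Euc n) (Euc n)}
    {G : QuadraticMap ℝ (Euc n) (Euc n)} {B : Set (Set (Euc n))} (h : StraightensWith Φ G B)
    (hB : IsCompleteBundle B) {Γ : QuadMap n} (hΓ : IsComplexification Γ G) : IsAdmissible Γ where
  real x := ⟨G x, hΓ x⟩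
  orthogonal x hx := by
    obtain ⟨u, v, rfl⟩ := exists_eq_toComplex_add x
    obtain ⟨h1, h2⟩ := (dotProduct_self_add_I_smul u v).mp hx
    rw [hΓ.apply_add_smul]
    exact (h.isotropic hB h1 h2).1
  isotropic x hx := by
    obtain ⟨u, v, rfl⟩ := exists_eq_toComplex_add x
    obtain ⟨h1, h2⟩ := (dotProduct_self_add_I_smul u v).mp hx
    rw [hΓ.apply_add_smul]
    exact (h.isotropic hB h1 h2).2

/-- The complex linear extension of a real linear functional. -/
theorem exists_complex_linear_extension (l : Euc n →ₗ[ℝ] ℝ) :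
    ∃ L : (Fin n → ℂ) →ₗ[ℂ] ℂ, ∀ x : Euc n, L (toComplex x) = l x := by
  refine ⟨∑ i, (l (EuclideanSpace.single i 1) : ℂ) • LinearMap.proj i, fun x => ?_⟩
  have hx : x = ∑ i, x i • EuclideanSpace.single i (1 : ℝ) := by
    ext k
    simp [Pi.single_apply]
  conv_rhs => rw [hx]
  simp [toComplex, mul_comm]

theorem exists_linear_of_isQuadraticPartOf {B : Set (Set (Euc n))} (hB : IsCompleteBundle B)
    {Γ Γ' : QuadMap n} (h : IsQuadraticPartOf Γ B) (h' : IsQuadraticPartOf Γ' B) :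
    ∃ L : (Fin n → ℂ) →ₗ[ℂ] ℂ, ∀ x, Γ' x = Γ x + L x • x := by
  obtain ⟨G, hG, Φ, hΦ⟩ := isQuadraticPartOf_iff.mp h
  obtain ⟨G', hG', Φ', hΦ'⟩ := isQuadraticPartOf_iff.mp h'
  obtain ⟨l, rfl⟩ := hΦ.exists_eq_add_smulSelf hΦ' hB
  obtain ⟨L, hL⟩ := exists_complex_linear_extension l
  let Q : QuadMap n := LinearMap.BilinMap.toQuadraticMap
    (LinearMap.comp (LinearMap.lsmul ℂ (Fin n → ℂ)) L)
  have hQ : ∀ x, Q x = L x • x := fun x => rfl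
  refine ⟨L, fun x => ?_⟩
  have hc : IsComplexification (Γ + Q) (G + smulSelf l) := fun y => by
    rw [add_apply, add_apply, hQ, hG y, hL, smulSelf_apply, toComplex_add, toComplex_smul]
  rw [hc.ext hG' x, add_apply, hQ]

theorem IsQuadraticPartOf.of_equiv {B : Set (Set (Euc n))} (hB : IsCompleteBundle B)
    {Γ Γ' : QuadMap n} (h : IsQuadraticPartOf Γ B) (hΓ' : IsAdmissible Γ')
    {L : (Fin n → ℂ) →ₗ[ℂ] ℂ} (hL : ∀ x, Γ' x = Γ x + L x • x) : IsQuadraticPartOf Γ' B := by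
  obtain ⟨G, hG, Φ, hΦ⟩ := isQuadraticPartOf_iff.mp h
  obtain ⟨G', hG'⟩ := exists_isComplexification_of_real hΓ'.real
  -- Since `Γ` and `Γ'` are real on `ℝⁿ`, taking real parts in `hL` allows `L` to be replaced there
  -- by its real part.
  let l : Euc n →ₗ[ℝ] ℝ :=
    Complex.reLm ∘ₗ (L.restrictScalars ℝ) ∘ₗ toComplexLinearMap n
  have hl : ∀ x, l x = (L (toComplex x)).re := fun x => rfl
  have hGG : G' = G + smulSelf l := by
    ext x i
    have h1 := congrArg Complex.re (congrFun (hL (toComplex x)) i)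
    rw [hG' x, hG x] at h1
    simpa [toComplex, hl] using h1
  obtain ⟨Φ', hΦ'⟩ := hΦ.add_smulSelf hB.toIsSimpleBundle l
  exact isQuadraticPartOf_iff.mpr ⟨G', hG', Φ', hGG ▸ hΦ'⟩

theorem IsQuadraticPartOf.bundle_eq {B B' : Set (Set (Euc n))} (hB : IsCompleteBundle B)
    (hB' : IsCompleteBundle B') {Γ : QuadMap n} (h : IsQuadraticPartOf Γ B)
    (h' : IsQuadraticPartOf Γ B') : B = B' := by
  obtain ⟨G, hG, Φ, hΦ⟩ := isQuadraticPartOf_iff.mp h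
  obtain ⟨G', hG', Φ', hΦ'⟩ := isQuadraticPartOf_iff.mp h'
  obtain rfl := hG.unique hG'
  rw [hΦ.eq_setOf hB, hΦ'.eq_setOf hB']

theorem StraightensWith.isRectifiable {Φ : OpenPartialHomeomorph (Euc n) (Euc n)}
    {G : QuadraticMap ℝ (Euc n) (Euc n)} {B : Set (Set (Euc n))} (h : StraightensWith Φ G B) :
    IsRectifiable B := by
  refine ⟨Φ.symm, ⟨?_, h.isDiffeoGerm.contDiffOn_symm, h.isDiffeoGerm.contDiffOn⟩, h.straightens⟩
  have := Φ.map_source h.isDiffeoGerm.zero_mem_source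
  rwa [h.map_zero] at this

theorem IsAdmissible.exists_bundle {Γ : QuadMap n} (hΓ : IsAdmissible Γ) :
    ∃ B : CompleteRectifiableBundle n, IsQuadraticPartOf Γ B.1 := by
  obtain ⟨G, hG⟩ := exists_isComplexification_of_real hΓ.real
  obtain ⟨l, hl⟩ := exists_linear_factor (G := G) fun u v huv ho =>
    orthogonal_identities (hΓ.isotropic_complexValue hG huv ho).1
  obtain ⟨Q, hQ⟩ := exists_quadratic_factor (G := G) fun u v huv ho =>
    isotropic_identities (hΓ.isotropic_complexValue hG huv ho).2
  -- With `G x - l(x) x` in place of `G`, the square norm becomes `(x, x) (Q - 2 l² + l²)`, whence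
  -- `μ = Q - l²`.
  obtain ⟨B, hB, Φ, hΦ⟩ := CircleBundle.exists_bundle (G := G + smulSelf (-l))
    (μ := Q - QuadraticMap.linMulLin l l)
    (fun x => by
      rw [add_apply, smulSelf_apply, inner_add_right, inner_smul_right, hl, LinearMap.neg_apply]
      ring)
    (fun x => by
      have := hl x
      rw [add_apply, smulSelf_apply, sub_apply, QuadraticMap.linMulLin_apply,
        LinearMap.neg_apply]
      simp only [inner_add_left, inner_add_right, inner_smul_left, inner_smul_right,
        RCLike.conj_to_real, hQ, real_inner_comm x (G x), hl]
      ring)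
  obtain ⟨Φ', hΦ'⟩ := hΦ.add_smulSelf hB.toIsSimpleBundle l
  have e : G + smulSelf (-l) + smulSelf l = G := by
    ext1 x
    simp only [add_apply, smulSelf_apply, LinearMap.neg_apply]
    module
  rw [e] at hΦ'
  exact ⟨⟨B, hB, hΦ.isRectifiable⟩, isQuadraticPartOf_iff.mpr ⟨G, hG, Φ', hΦ'⟩⟩

theorem exists_isQuadraticPartOf (B : CompleteRectifiableBundle n) :
    ∃ Γ : {Γ : QuadMap n // IsAdmissible Γ}, IsQuadraticPartOf Γ.1 B.1 := by
  obtain ⟨Φ, G, h⟩ := B.2.2.exists_straightensWith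
  obtain ⟨Γ, hΓ⟩ := exists_isComplexification G
  exact ⟨⟨Γ, h.isAdmissible B.2.1 hΓ⟩, isQuadraticPartOf_iff.mpr ⟨G, hΓ, Φ, h⟩⟩

end Correspondence

end CircleBundle

open CircleBundle

theorem mainTheorem3 (n : ℕ) :
    ∃ e : CircleBundle.CompleteRectifiableBundle n ≃
        Quotient (CircleBundle.admissibleSetoid n),
      ∀ (B : CircleBundle.CompleteRectifiableBundle n) (Γ : CircleBundle.QuadMap n),
        CircleBundle.IsQuadraticPartOf Γ B.1 ↔
          ∃ hΓ : CircleBundle.IsAdmissible Γ,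
            e B = Quotient.mk (CircleBundle.admissibleSetoid n) ⟨Γ, hΓ⟩ := by
  choose g hg using exists_isQuadraticPartOf (n := n)
  -- The quadratic parts of a bundle fill exactly one equivalence class, so the choice of `g` does
  -- not matter.
  have hiff : ∀ (B : CompleteRectifiableBundle n) (Γ : {Γ : QuadMap n // IsAdmissible Γ}),
      IsQuadraticPartOf Γ.1 B.1 ↔ Quotient.mk (admissibleSetoid n) (g B) = Quotient.mk _ Γ := by
    intro B Γ
    rw [Quotient.eq]
    constructor
    · exact fun h => exists_linear_of_isQuadraticPartOf B.2.1 (hg B) h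
    · rintro ⟨L, hL⟩
      exact (hg B).of_equiv B.2.1 Γ.2 hL
  refine ⟨Equiv.ofBijective (fun B => Quotient.mk (admissibleSetoid n) (g B)) ⟨?_, ?_⟩, ?_⟩
  · intro B B' h
    exact Subtype.ext ((hg B).bundle_eq B.2.1 B'.2.1 ((hiff B' (g B)).mpr h.symm))
  · intro q
    obtain ⟨Γ, rfl⟩ := Quotient.exists_rep q
    obtain ⟨B, hB⟩ := Γ.2.exists_bundle
    exact ⟨B, (hiff B Γ).mp hB⟩
  · intro B Γ
    constructor
    · intro h
      obtain ⟨G, hG, Φ, hΦ⟩ := isQuadraticPartOf_iff.mp h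
      have hΓ := hΦ.isAdmissible B.2.1 hG
      exact ⟨hΓ, (hiff B ⟨Γ, hΓ⟩).mp h⟩
    · rintro ⟨hΓ, h⟩
      exact (hiff B ⟨Γ, hΓ⟩).mpr h
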